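/- Let $T>0$, $\Lambda=[0,T]\times[0,T]$, let $\chi\in C^1([0,T])$ with $\chi'>0$ on $[0,T]$, and let $\gamma,\omega,s,\eta,\mathcal A\in C(\Lambda)$ with $\eta,\mathcal A\ge 0$. Write $f^-=\min_\Lambda f$, $f^+=\max_\Lambda f$, and assume $$1<\omega^-\le\omega^+<\gamma^-\le\gamma^+<s^-\le s^+ .$$ Let $0\le\beta\le1$ and $\alpha=(\alpha_1,\alpha_2)$ with $1/\gamma(\xi)<\alpha_j<1$ for all $\xi\in\Lambda$ and $j=1,2$ (in particular $\alpha_1=\alpha_2$ is allowed). For $a=(a_1,a_2)$ with $a_1,a_2>0$ let $$\mathbf I^{a,\chi}f(x,y)=\frac1{\Gamma(a_1)\Gamma(a_2)}\int_0^x\!\!\int_0^y\chi'(\sigma)(\chi(x)-\chi(\sigma))^{a_1-1}\chi'(\tau)(\chi(y)-\chi(\tau))^{a_2-1}f(\sigma,\tau)\,d\tau\,d\sigma$$ (the integration in the $j$-th variable being the identity if $a_j=0$). For $f\in C_0^\infty(\Lambda)$, that is, $f$ smooth with compact support in $(0,T)^2$, let $$\mathfrak D f=\mathbf I^{\beta(1-\alpha),\chi}\Big(\frac1{\chi'(x)\chi'(y)}\frac{\partial^2}{\partial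 x\,\partial y}\Big)\mathbf I^{(1-\beta)(1-\alpha),\chi}f$$ be its left-sided $\chi$-Hilfer derivative of order $\alpha$ and type $\beta$. Let $\mathscr L^{\gamma(\xi)}(\Lambda)$ be the space of measurable $f$ with $\int_\Lambda|f|^{\gamma(\xi)}d\xi<\infty$, and let $\mathcal H=\mathcal H^{\alpha,\beta;\chi}_{\gamma(\xi)}(\Lambda)$ be the closure of $C_0^\infty(\Lambda)$ in the norm $$\|\phi\|=\inf\Big\{k>0:\int_\Lambda\Big(\Big|\frac{\phi}{k}\Big|^{\gamma(\xi)}+\Big|\frac{\mathfrak D\phi}{k}\Big|^{\gamma(\xi)}\Big)d\xi\le1\Big\}.$$ That is, $\mathcal H$ consists of the $\phi\in\mathscr L^{\gamma(\xi)}(\Lambda)$ for which there are $\phi_n\in C_0^\infty(\Lambda)$ and $\mathfrak D\phi\in\mathscr L^{\gamma(\xi)}(\Lambda)$ such that $(\phi_n,\mathfrak D\phi_n)\to(\phi,\mathfrak D\phi)$ in this norm. For $\lambda>0$ and $\phi\in\mathcal H$ let $$\mathfrak E_\lambda(\phi)=\int_\Lambda\frac1{\gamma(\xi)}|\mathfrak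 D\phi|^{\gamma(\xi)}d\xi-\lambda\int_\Lambda\frac1{\omega(\xi)}\eta(\xi)|\phi|^{\omega(\xi)}d\xi-\int_\Lambda\frac1{s(\xi)}\mathcal A(\xi)|\phi|^{s(\xi)}d\xi ,$$ let $\mathbf I_\lambda(\phi)=\langle\mathfrak E_\lambda'(\phi),\phi\rangle$ (the derivative at $\phi$ in the direction $\phi$), and let $\mathfrak M_\lambda=\{\phi\in\mathcal H\setminus\{0\}:\mathbf I_\lambda(\phi)=0\}$, $\mathfrak M_\lambda^-=\{\phi\in\mathfrak M_\lambda:\langle\mathbf I_\lambda'(\phi),\phi\rangle<0\}$, $\mathfrak M_\lambda^0=\{\phi\in\mathfrak M_\lambda:\langle\mathbf I_\lambda'(\phi),\phi\rangle=0\}$. Then there is $\lambda_1>0$ such that for all $0<\lambda<\lambda_1$ one has $\mathfrak M_\lambda^0=\emptyset$, and $\mathfrak E_\lambda(\phi)>0$ for all $\phi\in\mathfrak M_\lambda^-$. -/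

import Mathlib

open Set MeasureTheory
open scoped ENNReal

noncomputable section

namespace HilferNehari

/-- The closed square `Λ = [0,T] × [0,T]`. -/
def square (T : ℝ) : Set (ℝ × ℝ) := Icc 0 T ×ˢ Icc 0 T

/-- The derivative `χ'` of `χ` on `[0,T]` (one-sided at the two end points). -/
def dchi (T : ℝ) (χ : ℝ → ℝ) (x : ℝ) : ℝ := derivWithin χ (Icc 0 T) x

/-- The one-dimensional left-sided `χ`-Riemann-Liouville integral of order `a ≥ 0`:
`(1/Γ(a)) ∫₀ˣ χ'(s) (χ(x) - χ(s))^(a-1) f(s) ds`; order zero is the identity. -/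
def fracInt₁ (T : ℝ) (χ : ℝ → ℝ) (a : ℝ) (f : ℝ → ℝ) (x : ℝ) : ℝ :=
  if a = 0 then f x
  else (Real.Gamma a)⁻¹ *
    ∫ s in (0 : ℝ)..x, dchi T χ s * (χ x - χ s) ^ (a - 1) * f s

/-- The two-dimensional left-sided `χ`-Riemann-Liouville integral of order `a = (a₁, a₂)`: order
`a₁` in the first variable and order `a₂` in the second. -/
def fracInt (T : ℝ) (χ : ℝ → ℝ) (a : ℝ × ℝ) (f : ℝ × ℝ → ℝ) (p : ℝ × ℝ) : ℝ :=
  fracInt₁ T χ a.1 (fun x => fracInt₁ T χ a.2 (fun y => f (x, y)) p.2) p.1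

/-- `(1 / (χ'(x) χ'(y))) ∂²g/∂x∂y`. -/
def mixedDeriv (T : ℝ) (χ : ℝ → ℝ) (g : ℝ × ℝ → ℝ) (p : ℝ × ℝ) : ℝ :=
  (dchi T χ p.1 * dchi T χ p.2)⁻¹ * deriv (fun x => deriv (fun y => g (x, y)) p.2) p.1

/-- The left-sided `χ`-Hilfer derivative of order `α = (α₁, α₂)` and type `β` of a smooth function,
`I^(β(1-α)) ∘ (1/(χ'χ') ∂²/∂x∂y) ∘ I^((1-β)(1-α))`. -/
def hilferDeriv (T : ℝ) (χ : ℝ → ℝ) (α : ℝ × ℝ) (β : ℝ) (f : ℝ × ℝ → ℝ) : ℝ × ℝ → ℝ :=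
  fracInt T χ (β * (1 - α.1), β * (1 - α.2))
    (mixedDeriv T χ (fracInt T χ ((1 - β) * (1 - α.1), (1 - β) * (1 - α.2)) f))

/-- `C₀^∞(Λ)`: smooth functions with compact support in the open square. -/
def IsTestFunction (T : ℝ) (f : ℝ × ℝ → ℝ) : Prop :=
  ContDiff ℝ (⊤ : ℕ∞) f ∧ HasCompactSupport f ∧ tsupport f ⊆ Ioo 0 T ×ˢ Ioo 0 T

/-- The variable exponent Lebesgue space on `Λ`: measurable `f` with `∫_Λ |f|^γ(ξ) dξ < ∞`. -/
def MemVarLp (T : ℝ) (γ : ℝ × ℝ → ℝ) (f : ℝ × ℝ → ℝ) : Prop :=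
  AEStronglyMeasurable f (volume.restrict (square T)) ∧
    ∫⁻ ξ in square T, ENNReal.ofReal (|f ξ| ^ γ ξ) < ∞

/-- The norm `inf {k > 0 : ∫_Λ (|φ/k|^γ(ξ) + |v/k|^γ(ξ)) dξ ≤ 1}` of the pair `(φ, v)`, `∞` if
there is no such `k`. With `v = Dφ` it is the Luxemburg norm of the fractional derivative space. -/
def graphNorm (T : ℝ) (γ : ℝ × ℝ → ℝ) (u : (ℝ × ℝ → ℝ) × (ℝ × ℝ → ℝ)) : ℝ≥0∞ :=
  ⨅ (k : ℝ) (_ : 0 < k)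
    (_ : ∫⁻ ξ in square T, ENNReal.ofReal (|u.1 ξ / k| ^ γ ξ + |u.2 ξ / k| ^ γ ξ) ≤ 1),
    ENNReal.ofReal k

/-- The fractional derivative space: the closure of `C₀^∞(Λ)` in the norm above. A member is
recorded as the pair `(φ, Dφ)`, where `Dφ ∈ L^γ(ξ)` is the limit of the `χ`-Hilfer derivatives of
the test functions that approximate `φ`; that is, the space is the closure of the graph of the
`χ`-Hilfer derivative on `C₀^∞(Λ)`. -/
def hilferSpace (T : ℝ) (χ : ℝ → ℝ) (α : ℝ × ℝ) (β : ℝ) (γ : ℝ × ℝ → ℝ) :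
    Set ((ℝ × ℝ → ℝ) × (ℝ × ℝ → ℝ)) :=
  {u | MemVarLp T γ u.1 ∧ MemVarLp T γ u.2 ∧
    ∀ ε : ℝ≥0∞, 0 < ε → ∃ ψ : ℝ × ℝ → ℝ, IsTestFunction T ψ ∧
      graphNorm T γ ((ψ, hilferDeriv T χ α β ψ) - u) < ε}

/-- The Euler functional
`∫_Λ |Dφ|^γ/γ - λ ∫_Λ η |φ|^ω/ω - ∫_Λ A |φ|^s/s` at `u = (φ, Dφ)`. -/
def energy (T : ℝ) (γ ω s η A : ℝ × ℝ → ℝ) (lam : ℝ) (u : (ℝ × ℝ → ℝ) × (ℝ × ℝ → ℝ)) : ℝ :=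
  (∫ ξ in square T, 1 / γ ξ * |u.2 ξ| ^ γ ξ)
    - lam * (∫ ξ in square T, 1 / ω ξ * η ξ * |u.1 ξ| ^ ω ξ)
    - ∫ ξ in square T, 1 / s ξ * A ξ * |u.1 ξ| ^ s ξ

/-- `I_λ(φ) = ⟨E_λ'(φ), φ⟩`, the derivative of the Euler functional at `φ` in the direction `φ`. -/
def nehariFun (T : ℝ) (γ ω s η A : ℝ × ℝ → ℝ) (lam : ℝ)
    (u : (ℝ × ℝ → ℝ) × (ℝ × ℝ → ℝ)) : ℝ :=
  lineDeriv ℝ (energy T γ ω s η A lam) u u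

/-- `⟨I_λ'(φ), φ⟩`. -/
def nehariFunDeriv (T : ℝ) (γ ω s η A : ℝ × ℝ → ℝ) (lam : ℝ)
    (u : (ℝ × ℝ → ℝ) × (ℝ × ℝ → ℝ)) : ℝ :=
  lineDeriv ℝ (nehariFun T γ ω s η A lam) u u

/-- The Nehari manifold: the `φ ≠ 0` in the fractional derivative space with
`⟨E_λ'(φ), φ⟩ = 0`. -/
def nehari (T : ℝ) (χ : ℝ → ℝ) (α : ℝ × ℝ) (β : ℝ) (γ ω s η A : ℝ × ℝ → ℝ) (lam : ℝ) :
    Set ((ℝ × ℝ → ℝ) × (ℝ × ℝ → ℝ)) :=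
  {u | u ∈ hilferSpace T χ α β γ ∧ ¬ (u.1 =ᵐ[volume.restrict (square T)] 0) ∧
    nehariFun T γ ω s η A lam u = 0}

/-- The degenerate part `⟨I_λ'(φ), φ⟩ = 0` of the Nehari manifold. -/
def nehariZero (T : ℝ) (χ : ℝ → ℝ) (α : ℝ × ℝ) (β : ℝ) (γ ω s η A : ℝ × ℝ → ℝ) (lam : ℝ) :
    Set ((ℝ × ℝ → ℝ) × (ℝ × ℝ → ℝ)) :=
  {u | u ∈ nehari T χ α β γ ω s η A lam ∧ nehariFunDeriv T γ ω s η A lam u = 0}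

/-- The part `⟨I_λ'(φ), φ⟩ < 0` of the Nehari manifold. -/
def nehariNeg (T : ℝ) (χ : ℝ → ℝ) (α : ℝ × ℝ) (β : ℝ) (γ ω s η A : ℝ × ℝ → ℝ) (lam : ℝ) :
    Set ((ℝ × ℝ → ℝ) × (ℝ × ℝ → ℝ)) :=
  {u | u ∈ nehari T χ α β γ ω s η A lam ∧ nehariFunDeriv T γ ω s η A lam u < 0}

/-- `f⁻ = inf_Λ f` (the essential infimum, for `f` continuous on `Λ` and `T > 0`). -/
def infOn (T : ℝ) (f : ℝ × ℝ → ℝ) : ℝ := sInf (f '' square T)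

/-- `f⁺ = sup_Λ f` (the essential supremum, for `f` continuous on `Λ` and `T > 0`). -/
def supOn (T : ℝ) (f : ℝ × ℝ → ℝ) : ℝ := sSup (f '' square T)

end HilferNehari

end

/-! Write D, W, S for the integrals over Λ of |Dφ|^γ, η|φ|^ω and A|φ|^s. Scaling by 1 + t multiplies
|v|^e by (1 + t)^e, so both line derivatives are explicit: the Nehari constraint is D = λW + S, and
the second derivative has the extra weights γ, ω, s under the integrals. If the latter is ≤ 0,
eliminating λW gives (γ⁻ - ω⁺) D ≤ (s⁺ - ω⁺) S. Since S ≤ K D^(s⁻/γ⁺) for D ≤ 1 and s⁻ > γ⁺, D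
cannot be small: D ≥ d with d independent of λ. For such D one has W ≤ (B/d) D, so λW is a small
multiple of D for small λ. A vanishing second derivative would force (s⁻ - γ⁺) D ≤ (s⁻ - ω⁻) λW,
which is then impossible, and the energy is at least (1/γ⁺ - 1/s⁻) D - λW/ω⁻ > 0.

The bounds on S and W (`exists_estimates_of_mem_hilferSpace`) come from an embedding into L^∞
(`exists_ae_bound_of_mem_hilferSpace`). A test function is ψ = I^1 w with w its weighted mixed
derivative; the semigroup law `rlInt_rlInt` turns its Hilfer derivative into I^(1-α) w, whatever β
is, so ψ = I^α(Dψ). The kernel of I^α lies in L^q, q conjugate to γ⁻, because α_j > 1/γ⁻; Young's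
inequality then bounds ψ uniformly, and Chebyshev's inequality carries the bound to the closure. The
kernels vanish off 0 < s < x < T, so every integral runs over the whole line or plane. -/

namespace HilferNehari

/-! ### The one-dimensional kernel: Beta integral, semigroup law, integrability. -/

section

/-- Euler's Beta integral, scaled and translated; the complex version is transferred to real powers,
all bases being nonnegative. -/
theorem integral_rpow_mul_rpow_Ioo {a b c d : ℝ} (ha : 0 < a) (hb : 0 < b) (hcd : c < d) :
    ∫ u in Ioo c d, (d - u) ^ (a - 1) * (u - c) ^ (b - 1) =
      Real.Gamma a * Real.Gamma b / Real.Gamma (a + b) * (d - c) ^ (a + b - 1) := by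
  have hL : 0 < d - c := sub_pos.2 hcd
  have h1 := Complex.betaIntegral_scaled (b : ℂ) (a : ℂ) hL
  have h2 := Complex.Gamma_mul_Gamma_eq_betaIntegral (s := (b : ℂ)) (t := (a : ℂ))
    (by simpa using hb) (by simpa using ha)
  have h3 : Complex.Gamma ((b : ℂ) + a) ≠ 0 := by
    rw [← Complex.ofReal_add, Complex.Gamma_ofReal]
    exact_mod_cast (Real.Gamma_pos_of_pos (by positivity)).ne'
  have h4 : Complex.betaIntegral (b : ℂ) a =
      ((Real.Gamma a * Real.Gamma b / Real.Gamma (a + b) : ℝ) : ℂ) := by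
    push_cast
    simp only [← Complex.Gamma_ofReal]
    push_cast
    rw [add_comm (a : ℂ) b, eq_div_iff h3, mul_comm (Complex.Gamma a), h2, mul_comm]
  have h5 : ∫ x in (0 : ℝ)..(d - c), (x : ℂ) ^ ((b : ℂ) - 1) *
      (((d - c : ℝ) : ℂ) - x) ^ ((a : ℂ) - 1) =
      ((∫ x in (0 : ℝ)..(d - c), ((d - c) - x) ^ (a - 1) * x ^ (b - 1) : ℝ) : ℂ) := by
    rw [← intervalIntegral.integral_ofReal]
    refine intervalIntegral.integral_congr fun x hx => ?_
    rw [uIcc_of_le hL.le] at hx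
    push_cast
    rw [Complex.ofReal_cpow hx.1, mul_comm, ← Complex.ofReal_sub, ← Complex.ofReal_sub,
      Complex.ofReal_cpow (sub_nonneg.2 hx.2)]
    push_cast
    rfl
  rw [h5, h4] at h1
  have h6 : (((d - c : ℝ) : ℂ)) ^ ((b : ℂ) + a - 1) = (((d - c) ^ (a + b - 1) : ℝ) : ℂ) := by
    rw [Complex.ofReal_cpow hL.le, add_comm a b]
    push_cast
    rfl
  rw [h6] at h1
  have h7 : ∫ x in (0 : ℝ)..(d - c), ((d - c) - x) ^ (a - 1) * x ^ (b - 1) =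
      Real.Gamma a * Real.Gamma b / Real.Gamma (a + b) * (d - c) ^ (a + b - 1) := by
    rw [mul_comm]
    exact_mod_cast h1
  rw [← h7, ← integral_Ioc_eq_integral_Ioo, ← intervalIntegral.integral_of_le hcd.le]
  have h8 := intervalIntegral.integral_comp_sub_right (a := c) (b := d)
    (fun x => ((d - c) - x) ^ (a - 1) * x ^ (b - 1)) c
  rw [sub_self] at h8
  rw [← h8]
  simp only [sub_sub_sub_cancel_right]

/-- The hypotheses on `χ`: continuously differentiable on `[0,T]` with positive derivative. -/
structure Admissible (T : ℝ) (χ : ℝ → ℝ) : Prop where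
  pos : 0 < T
  contDiffOn : ContDiffOn ℝ 1 χ (Icc 0 T)
  dchi_pos : ∀ x ∈ Icc 0 T, 0 < dchi T χ x

/-- The kernel of the one-dimensional `χ`-Riemann-Liouville integral of order `a > 0`. -/
noncomputable def rlKernel (T : ℝ) (χ : ℝ → ℝ) (a x s : ℝ) : ℝ :=
  if 0 < s ∧ s < x ∧ x < T then (Real.Gamma a)⁻¹ * (dchi T χ s * (χ x - χ s) ^ (a - 1)) else 0

variable {T : ℝ} {χ : ℝ → ℝ} {a b x y s : ℝ}

namespace Admissible

theorem continuousOn (h : Admissible T χ) : ContinuousOn χ (Icc 0 T) := h.contDiffOn.continuousOn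

theorem continuousOn_dchi (h : Admissible T χ) : ContinuousOn (dchi T χ) (Icc 0 T) :=
  h.contDiffOn.continuousOn_derivWithin (uniqueDiffOn_Icc h.pos) le_rfl

theorem hasDerivWithinAt (h : Admissible T χ) (hx : x ∈ Icc 0 T) :
    HasDerivWithinAt χ (dchi T χ x) (Icc 0 T) x :=
  (h.contDiffOn.differentiableOn one_ne_zero x hx).hasDerivWithinAt

theorem strictMonoOn (h : Admissible T χ) : StrictMonoOn χ (Icc 0 T) := by
  refine strictMonoOn_of_deriv_pos (convex_Icc 0 T) h.continuousOn fun x hx => ?_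
  rw [interior_Icc] at hx
  rw [← derivWithin_of_mem_nhds (Icc_mem_nhds hx.1 hx.2)]
  exact h.dchi_pos x (Ioo_subset_Icc_self hx)

theorem image_Ioo (h : Admissible T χ) {c d : ℝ} (hc : 0 ≤ c) (hcd : c ≤ d) (hd : d ≤ T) :
    χ '' Ioo c d = Ioo (χ c) (χ d) := by
  have hsub : Icc c d ⊆ Icc 0 T := Icc_subset_Icc hc hd
  refine Subset.antisymm ?_ (intermediate_value_Ioo hcd (h.continuousOn.mono hsub))
  rintro _ ⟨r, hr, rfl⟩
  exact ⟨h.strictMonoOn (hsub (left_mem_Icc.2 hcd)) (hsub (Ioo_subset_Icc_self hr)) hr.1,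
    h.strictMonoOn (hsub (Ioo_subset_Icc_self hr)) (hsub (right_mem_Icc.2 hcd)) hr.2⟩

/-- The substitution u = χ(r) reduces every χ-kernel to the classical one. -/
theorem integral_comp (h : Admissible T χ) {c d : ℝ} (hc : 0 ≤ c) (hcd : c ≤ d) (hd : d ≤ T)
    (F : ℝ → ℝ) :
    ∫ r in Ioo c d, dchi T χ r * F (χ r) = ∫ u in Ioo (χ c) (χ d), F u := by
  have hsub : Ioo c d ⊆ Icc 0 T := Ioo_subset_Icc_self.trans (Icc_subset_Icc hc hd)
  rw [← h.image_Ioo hc hcd hd]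
  exact (integral_image_eq_integral_deriv_smul_of_monotoneOn measurableSet_Ioo
    (fun x hx => (h.hasDerivWithinAt (hsub hx)).mono hsub)
    (h.strictMonoOn.monotoneOn.mono hsub) F).symm

theorem integral_kernel_Ioo (h : Admissible T χ) (ha : 0 < a) (hb : 0 < b) (hs : 0 ≤ s)
    (hsx : s < x) (hx : x ≤ T) :
    ∫ r in Ioo s x, dchi T χ r * ((χ x - χ r) ^ (a - 1) * (χ r - χ s) ^ (b - 1)) =
      Real.Gamma a * Real.Gamma b / Real.Gamma (a + b) * (χ x - χ s) ^ (a + b - 1) := by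
  rw [h.integral_comp hs hsx.le hx (fun u => (χ x - u) ^ (a - 1) * (u - χ s) ^ (b - 1))]
  exact integral_rpow_mul_rpow_Ioo ha hb
    (h.strictMonoOn ⟨hs, hsx.le.trans hx⟩ ⟨hs.trans hsx.le, hx⟩ hsx)

theorem rlKernel_nonneg (h : Admissible T χ) (ha : 0 < a) : 0 ≤ rlKernel T χ a x s := by
  unfold rlKernel
  split_ifs with hc
  · have h1 := h.dchi_pos s ⟨hc.1.le, (hc.2.1.trans hc.2.2).le⟩
    have h2 := h.strictMonoOn.monotoneOn ⟨hc.1.le, (hc.2.1.trans hc.2.2).le⟩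
      ⟨(hc.1.trans hc.2.1).le, hc.2.2.le⟩ hc.2.1.le
    have h3 := Real.Gamma_pos_of_pos ha
    have h4 := Real.rpow_nonneg (sub_nonneg.2 h2) (a - 1)
    positivity
  · exact le_rfl

/-- The semigroup property of the kernels. -/
theorem integral_rlKernel_mul (h : Admissible T χ) (ha : 0 < a) (hb : 0 < b) :
    ∫ r, rlKernel T χ a x r * rlKernel T χ b r s = rlKernel T χ (a + b) x s := by
  by_cases hc : 0 < s ∧ s < x ∧ x < T
  · have h1 : (fun r => rlKernel T χ a x r * rlKernel T χ b r s) = (Ioo s x).indicator (fun r =>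
        ((Real.Gamma a)⁻¹ * (Real.Gamma b)⁻¹ * dchi T χ s) *
          (dchi T χ r * ((χ x - χ r) ^ (a - 1) * (χ r - χ s) ^ (b - 1)))) := by
      ext r
      by_cases hr : r ∈ Ioo s x
      · rw [indicator_of_mem hr, rlKernel, rlKernel,
          if_pos ⟨hc.1.trans hr.1, hr.2, hc.2.2⟩, if_pos ⟨hc.1, hr.1, hr.2.trans hc.2.2⟩]
        ring
      · rw [indicator_of_notMem hr, rlKernel, rlKernel]
        by_cases hrx : r < x
        · rw [if_neg (c := 0 < s ∧ _) (fun h => hr ⟨h.2.1, hrx⟩), mul_zero]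
        · rw [if_neg (fun h => hrx h.2.1), zero_mul]
    rw [h1, integral_indicator measurableSet_Ioo, integral_const_mul,
      h.integral_kernel_Ioo ha hb hc.1.le hc.2.1 hc.2.2.le, rlKernel, if_pos hc]
    have := (Real.Gamma_pos_of_pos ha).ne'
    have := (Real.Gamma_pos_of_pos hb).ne'
    field_simp
  · rw [rlKernel, if_neg hc, ← integral_zero ℝ ℝ (μ := volume)]
    refine integral_congr_ae (.of_forall fun r => ?_)
    simp only [rlKernel]
    split_ifs with h1 h2
    · exact absurd ⟨h2.1, h2.2.1.trans h1.2.1, h1.2.2⟩ hc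
    all_goals simp

theorem integral_rlKernel_Ioo (h : Admissible T χ) (ha : 0 < a) (hy : 0 ≤ y) (hyx : y ≤ x)
    (hx0 : 0 < x) (hx : x < T) :
    ∫ r in Ioo y x, rlKernel T χ a x r = (Real.Gamma (a + 1))⁻¹ * (χ x - χ y) ^ a := by
  rcases hyx.eq_or_lt with rfl | hyx
  · simp [ha.ne']
  -- A factor with exponent `1 - 1` is inserted: this is the Beta integral with b = 1.
  have h1 : ∫ r in Ioo y x, rlKernel T χ a x r = ∫ r in Ioo y x, (Real.Gamma a)⁻¹ *
      (dchi T χ r * ((χ x - χ r) ^ (a - 1) * (χ r - χ y) ^ ((1 : ℝ) - 1))) := by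
    refine setIntegral_congr_fun measurableSet_Ioo fun r hr => ?_
    simp [rlKernel, hy.trans_lt hr.1, hr.2, hx]
  rw [h1, integral_const_mul, h.integral_kernel_Ioo ha one_pos hy hyx hx.le]
  have := (Real.Gamma_pos_of_pos ha).ne'
  rw [Real.Gamma_one, add_sub_cancel_right]
  field_simp

theorem rlKernel_eq_indicator :
    rlKernel T χ a x = (Ioo 0 x).indicator (rlKernel T χ a x) := by
  ext r
  by_cases hr : r ∈ Ioo 0 x
  · rw [indicator_of_mem hr]
  · rw [indicator_of_notMem hr, rlKernel, if_neg fun h => hr ⟨h.1, h.2.1⟩]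

theorem rlKernel_eq_zero (hx : x ∉ Ioo 0 T) : rlKernel T χ a x = 0 := by
  ext r
  rw [rlKernel, if_neg fun h => hx ⟨h.1.trans h.2.1, h.2.2⟩]
  rfl

theorem integral_rlKernel (h : Admissible T χ) (ha : 0 < a) (hx : x ∈ Ioo 0 T) :
    ∫ r, rlKernel T χ a x r = (Real.Gamma (a + 1))⁻¹ * (χ x - χ 0) ^ a := by
  rw [rlKernel_eq_indicator, integral_indicator measurableSet_Ioo,
    h.integral_rlKernel_Ioo ha le_rfl hx.1.le hx.1 hx.2]

theorem integrable_rlKernel (h : Admissible T χ) (ha : 0 < a) : Integrable (rlKernel T χ a x) := by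
  by_cases hx : x ∈ Ioo 0 T
  -- A non-integrable function has Bochner integral 0, so the nonzero value already computed forces
  -- integrability.
  · refine not_imp_comm.1 integral_undef ?_
    rw [h.integral_rlKernel ha hx]
    have h1 := h.strictMonoOn ⟨le_rfl, h.pos.le⟩ (Ioo_subset_Icc_self hx) hx.1
    have h2 := Real.Gamma_pos_of_pos (show 0 < a + 1 by positivity)
    have h3 := Real.rpow_pos_of_pos (sub_pos.2 h1) a
    positivity
  · rw [rlKernel_eq_zero hx]
    exact integrable_zero _ _ _

theorem exists_integral_rlKernel_le (h : Admissible T χ) (ha : 0 < a) :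
    ∃ C, 0 ≤ C ∧ ∀ x, ∫ r, rlKernel T χ a x r ≤ C := by
  have h2 := Real.Gamma_pos_of_pos (show 0 < a + 1 by positivity)
  have h0 : χ 0 ≤ χ T := h.strictMonoOn.monotoneOn ⟨le_rfl, h.pos.le⟩ ⟨h.pos.le, le_rfl⟩ h.pos.le
  have h3 : 0 ≤ (Real.Gamma (a + 1))⁻¹ * (χ T - χ 0) ^ a :=
    mul_nonneg (inv_nonneg.2 h2.le) (Real.rpow_nonneg (sub_nonneg.2 h0) _)
  refine ⟨_, h3, fun x => ?_⟩
  by_cases hx : x ∈ Ioo 0 T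
  · rw [h.integral_rlKernel ha hx]
    have h1 := h.strictMonoOn.monotoneOn ⟨le_rfl, h.pos.le⟩ (Ioo_subset_Icc_self hx) hx.1.le
    have h4 := h.strictMonoOn.monotoneOn (Ioo_subset_Icc_self hx) ⟨h.pos.le, le_rfl⟩ hx.2.le
    gcongr
  · simpa [rlKernel_eq_zero hx] using h3

/-- On the region where it is not cut off, χ x - χ s is nonzero, so the kernel is continuous there
despite its singularity on the diagonal. -/
theorem measurable_rlKernel (h : Admissible T χ) :
    Measurable fun p : ℝ × ℝ => rlKernel T χ a p.1 p.2 := by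
  set U : Set (ℝ × ℝ) := {p | 0 < p.2 ∧ p.2 < p.1 ∧ p.1 < T} with hU
  have hUm : MeasurableSet U := by
    refine MeasurableSet.inter ?_ (MeasurableSet.inter ?_ ?_)
    · exact measurableSet_lt measurable_const measurable_snd
    · exact measurableSet_lt measurable_snd measurable_fst
    · exact measurableSet_lt measurable_fst measurable_const
  have h1 : MapsTo Prod.fst U (Icc 0 T) := fun p hp => ⟨(hp.1.trans hp.2.1).le, hp.2.2.le⟩
  have h2 : MapsTo Prod.snd U (Icc 0 T) := fun p hp => ⟨hp.1.le, (hp.2.1.trans hp.2.2).le⟩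
  have hc : ContinuousOn (fun p : ℝ × ℝ =>
      (Real.Gamma a)⁻¹ * (dchi T χ p.2 * (χ p.1 - χ p.2) ^ (a - 1))) U := by
    refine continuousOn_const.mul ((h.continuousOn_dchi.comp continuousOn_snd h2).mul ?_)
    refine ContinuousOn.rpow_const ((h.continuousOn.comp continuousOn_fst h1).sub
      (h.continuousOn.comp continuousOn_snd h2)) fun p hp => Or.inl ?_
    exact (sub_pos.2 (h.strictMonoOn (h2 hp) (h1 hp) hp.2.1)).ne'
  classical
  have := ContinuousOn.measurable_piecewise hc (continuousOn_const (c := (0 : ℝ))) hUm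
  convert this using 1
  ext p
  simp only [rlKernel, Set.piecewise, hU, mem_ofPred_eq]

end Admissible

end

/-! ### The two-dimensional integral: continuity, Fubini, semigroup law. -/

section

variable {T : ℝ} {χ : ℝ → ℝ} {a b x y s : ℝ}

/-- The two-dimensional `χ`-Riemann-Liouville integral of positive order in kernel form. -/
noncomputable def rlInt (T : ℝ) (χ : ℝ → ℝ) (a : ℝ × ℝ) (f : ℝ × ℝ → ℝ) (p : ℝ × ℝ) : ℝ :=
  ∫ q : ℝ × ℝ, rlKernel T χ a.1 p.1 q.1 * rlKernel T χ a.2 p.2 q.2 * f q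

namespace Admissible

theorem measurable_rlKernel_right (h : Admissible T χ) : Measurable (rlKernel T χ a x) :=
  h.measurable_rlKernel.comp measurable_prodMk_left

theorem integrable_rlKernel_mul (h : Admissible T χ) (ha : 0 < a) {g : ℝ → ℝ} (hg : Measurable g)
    {M : ℝ} (hM : ∀ r, |g r| ≤ M) : Integrable fun r => rlKernel T χ a x r * g r :=
  (h.integrable_rlKernel ha).mul_bdd hg.aestronglyMeasurable (.of_forall hM)

/-- For a ≤ 1 the kernel decreases in its upper limit, so the absolute difference is K_y - K_x left
of y and K_x on [y, x). Hence it equals K_y - K_x + 2 K_x 1_[y,x) everywhere, and the integral of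
K_y - K_x is nonpositive by the explicit formula. -/
theorem integral_abs_rlKernel_sub_le (h : Admissible T χ) (ha : 0 < a) (ha1 : a ≤ 1)
    (hy : y ∈ Ioo 0 T) (hx : x ∈ Ioo 0 T) (hyx : y ≤ x) :
    ∫ r, |rlKernel T χ a x r - rlKernel T χ a y r| ≤
      2 * ((Real.Gamma (a + 1))⁻¹ * (χ x - χ y) ^ a) := by
  have h1 : ∀ r, |rlKernel T χ a x r - rlKernel T χ a y r| =
      rlKernel T χ a y r - rlKernel T χ a x r +
        2 * (Ico y x).indicator (rlKernel T χ a x) r := by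
    intro r
    by_cases hr : r < y
    · rw [indicator_of_notMem fun h => hr.not_ge h.1, mul_zero, add_zero, abs_sub_comm]
      refine abs_of_nonneg (sub_nonneg.2 ?_)
      by_cases hr0 : 0 < r
      · rw [rlKernel, rlKernel, if_pos (c := _ ∧ r < x ∧ _) ⟨hr0, hr.trans_le hyx, hx.2⟩,
          if_pos ⟨hr0, hr, hy.2⟩]
        have hrT : r ∈ Icc 0 T := ⟨hr0.le, (hr.trans hy.2).le⟩
        have h2 := h.dchi_pos r hrT
        have h3 := Real.Gamma_pos_of_pos ha
        have h4 := h.strictMonoOn hrT (Ioo_subset_Icc_self hy) hr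
        have h5 := h.strictMonoOn.monotoneOn (Ioo_subset_Icc_self hy) (Ioo_subset_Icc_self hx) hyx
        have h6 : (χ x - χ r) ^ (a - 1) ≤ (χ y - χ r) ^ (a - 1) :=
          Real.rpow_le_rpow_of_nonpos (sub_pos.2 h4) (by linarith) (by linarith)
        gcongr
      · simp [rlKernel, hr0]
    · have h2 : rlKernel T χ a y r = 0 := by simp [rlKernel, hr]
      have h3 : (Ico y x).indicator (rlKernel T χ a x) r = rlKernel T χ a x r := by
        by_cases hrx : r < x
        · exact indicator_of_mem (show r ∈ Ico y x from ⟨not_lt.1 hr, hrx⟩) _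
        · rw [indicator_of_notMem fun h => hrx h.2, rlKernel, if_neg fun h => hrx h.2.1]
      rw [h2, h3, sub_zero, abs_of_nonneg (h.rlKernel_nonneg ha)]
      ring
  simp only [h1]
  have hi : Integrable fun r => rlKernel T χ a y r - rlKernel T χ a x r :=
    (h.integrable_rlKernel ha).sub (h.integrable_rlKernel ha)
  rw [integral_add hi (((h.integrable_rlKernel ha).indicator measurableSet_Ico).const_mul 2),
    integral_sub (h.integrable_rlKernel ha) (h.integrable_rlKernel ha), integral_const_mul,
    integral_indicator measurableSet_Ico, integral_Ico_eq_integral_Ioo,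
    h.integral_rlKernel_Ioo ha hy.1.le hyx hx.1 hx.2, h.integral_rlKernel ha hx,
    h.integral_rlKernel ha hy]
  have h5 := h.strictMonoOn.monotoneOn (Ioo_subset_Icc_self hy) (Ioo_subset_Icc_self hx) hyx
  have h6 := h.strictMonoOn.monotoneOn ⟨le_rfl, h.pos.le⟩ (Ioo_subset_Icc_self hy) hy.1.le
  have h7 : (Real.Gamma (a + 1))⁻¹ * (χ y - χ 0) ^ a ≤
      (Real.Gamma (a + 1))⁻¹ * (χ x - χ 0) ^ a := by
    have h2 := Real.Gamma_pos_of_pos (show 0 < a + 1 by positivity)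
    have := sub_nonneg.2 h6
    gcongr
  linarith

theorem abs_integral_rlKernel_mul_le (h : Admissible T χ) (ha : 0 < a) {g : ℝ → ℝ}
    {M C : ℝ} (hM : ∀ r, |g r| ≤ M) (hC : ∫ r, rlKernel T χ a x r ≤ C) :
    |∫ r, rlKernel T χ a x r * g r| ≤ C * M := by
  have hM0 : 0 ≤ M := (abs_nonneg _).trans (hM 0)
  calc |∫ r, rlKernel T χ a x r * g r| ≤ ∫ r, rlKernel T χ a x r * M := by
        rw [← Real.norm_eq_abs]
        refine norm_integral_le_of_norm_le ((h.integrable_rlKernel ha).mul_const M)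
          (.of_forall fun r => ?_)
        rw [Real.norm_eq_abs, abs_mul, abs_of_nonneg (h.rlKernel_nonneg ha)]
        exact mul_le_mul_of_nonneg_left (hM r) (h.rlKernel_nonneg ha)
    _ ≤ C * M := by
        rw [integral_mul_const]
        gcongr

/-- The kernel depends continuously on x in L¹, so no regularity of g beyond boundedness and
measurability is needed. -/
theorem continuousAt_integral_rlKernel_mul (h : Admissible T χ) (ha : 0 < a) (ha1 : a ≤ 1)
    {g : ℝ → ℝ} (hg : Measurable g) {M : ℝ} (hM : ∀ r, |g r| ≤ M) (hx : x ∈ Ioo 0 T) :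
    ContinuousAt (fun y => ∫ r, rlKernel T χ a y r * g r) x := by
  have hM0 : 0 ≤ M := (abs_nonneg _).trans (hM 0)
  have key : ∀ y ∈ Ioo 0 T, ∫ r, |rlKernel T χ a y r - rlKernel T χ a x r| ≤
      2 * ((Real.Gamma (a + 1))⁻¹ * |χ y - χ x| ^ a) := by
    intro y hy
    rcases le_total x y with hxy | hxy
    · rw [abs_of_nonneg (sub_nonneg.2 (h.strictMonoOn.monotoneOn (Ioo_subset_Icc_self hx)
        (Ioo_subset_Icc_self hy) hxy))]
      exact h.integral_abs_rlKernel_sub_le ha ha1 hx hy hxy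
    · rw [abs_sub_comm, abs_of_nonneg (sub_nonneg.2 (h.strictMonoOn.monotoneOn
        (Ioo_subset_Icc_self hy) (Ioo_subset_Icc_self hx) hxy))]
      simp only [abs_sub_comm (rlKernel T χ a y _)]
      exact h.integral_abs_rlKernel_sub_le ha ha1 hy hx hxy
  have hχ : ContinuousAt χ x := h.continuousOn.continuousAt (Icc_mem_nhds hx.1 hx.2)
  have hlim : Filter.Tendsto (fun y => M * (2 * ((Real.Gamma (a + 1))⁻¹ * |χ y - χ x| ^ a)))
      (nhds x) (nhds 0) := by
    have : ContinuousAt (fun y => M * (2 * ((Real.Gamma (a + 1))⁻¹ * |χ y - χ x| ^ a))) x := by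
      refine continuousAt_const.mul (continuousAt_const.mul (continuousAt_const.mul ?_))
      exact ((hχ.sub continuousAt_const).abs).rpow_const (Or.inr ha.le)
    simpa [ContinuousAt, ha.ne'] using this
  rw [ContinuousAt, tendsto_iff_dist_tendsto_zero]
  refine squeeze_zero' (.of_forall fun _ => dist_nonneg) ?_ hlim
  filter_upwards [Ioo_mem_nhds hx.1 hx.2] with y hy
  have hi := ((h.integrable_rlKernel ha (x := y)).sub (h.integrable_rlKernel ha (x := x))).abs
  rw [Real.dist_eq, ← integral_sub (h.integrable_rlKernel_mul ha hg hM)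
    (h.integrable_rlKernel_mul ha hg hM)]
  calc |∫ r, (rlKernel T χ a y r * g r - rlKernel T χ a x r * g r)|
      ≤ ∫ r, M * |rlKernel T χ a y r - rlKernel T χ a x r| := by
        rw [← Real.norm_eq_abs]
        refine norm_integral_le_of_norm_le (hi.const_mul M) (.of_forall fun r => ?_)
        rw [← sub_mul, Real.norm_eq_abs, abs_mul, mul_comm]
        exact mul_le_mul_of_nonneg_right (hM r) (abs_nonneg _)
    _ ≤ _ := by
        rw [integral_const_mul]
        exact mul_le_mul_of_nonneg_left (key y hy) hM0

theorem integrable_rlKernel₂ (h : Admissible T χ) {a : ℝ × ℝ} (ha₁ : 0 < a.1) (ha₂ : 0 < a.2)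
    {p : ℝ × ℝ} :
    Integrable fun q : ℝ × ℝ => rlKernel T χ a.1 p.1 q.1 * rlKernel T χ a.2 p.2 q.2 :=
  (h.integrable_rlKernel ha₁).mul_prod (h.integrable_rlKernel ha₂)

theorem measurable_rlKernel₂ (h : Admissible T χ) {a : ℝ × ℝ} :
    Measurable fun z : (ℝ × ℝ) × (ℝ × ℝ) =>
      rlKernel T χ a.1 z.1.1 z.2.1 * rlKernel T χ a.2 z.1.2 z.2.2 := by
  refine Measurable.mul ?_ ?_
  · exact h.measurable_rlKernel.comp
      (f := fun z : (ℝ × ℝ) × (ℝ × ℝ) => (z.1.1, z.2.1)) (by fun_prop)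
  · exact h.measurable_rlKernel.comp
      (f := fun z : (ℝ × ℝ) × (ℝ × ℝ) => (z.1.2, z.2.2)) (by fun_prop)

theorem integrable_rlKernel₂_mul (h : Admissible T χ) {a : ℝ × ℝ} (ha₁ : 0 < a.1) (ha₂ : 0 < a.2)
    {p : ℝ × ℝ} {f : ℝ × ℝ → ℝ} (hf : Measurable f) {M : ℝ} (hM : ∀ q, |f q| ≤ M) :
    Integrable fun q : ℝ × ℝ => rlKernel T χ a.1 p.1 q.1 * rlKernel T χ a.2 p.2 q.2 * f q :=
  (h.integrable_rlKernel₂ ha₁ ha₂).mul_bdd hf.aestronglyMeasurable (.of_forall hM)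

theorem rlKernel₂_nonneg (h : Admissible T χ) {a : ℝ × ℝ} (ha₁ : 0 < a.1) (ha₂ : 0 < a.2)
    {p q : ℝ × ℝ} : 0 ≤ rlKernel T χ a.1 p.1 q.1 * rlKernel T χ a.2 p.2 q.2 :=
  mul_nonneg (h.rlKernel_nonneg ha₁) (h.rlKernel_nonneg ha₂)

theorem exists_integral_rlKernel₂_le (h : Admissible T χ) {a : ℝ × ℝ} (ha₁ : 0 < a.1)
    (ha₂ : 0 < a.2) : ∃ C, 0 ≤ C ∧ ∀ p : ℝ × ℝ,
      ∫ q : ℝ × ℝ, rlKernel T χ a.1 p.1 q.1 * rlKernel T χ a.2 p.2 q.2 ≤ C := by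
  obtain ⟨C₁, h₁, hC₁⟩ := h.exists_integral_rlKernel_le ha₁
  obtain ⟨C₂, h₂, hC₂⟩ := h.exists_integral_rlKernel_le ha₂
  refine ⟨C₁ * C₂, mul_nonneg h₁ h₂, fun p => ?_⟩
  rw [Measure.volume_eq_prod, integral_prod_mul]
  exact mul_le_mul (hC₁ _) (hC₂ _) (integral_nonneg fun _ => h.rlKernel_nonneg ha₂) h₁

theorem exists_abs_rlInt_le (h : Admissible T χ) {a : ℝ × ℝ} (ha₁ : 0 < a.1) (ha₂ : 0 < a.2)
    {f : ℝ × ℝ → ℝ} {M : ℝ} (hM : ∀ q, |f q| ≤ M) : ∃ C, ∀ p, |rlInt T χ a f p| ≤ C := by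
  obtain ⟨C, hC0, hC⟩ := h.exists_integral_rlKernel₂_le ha₁ ha₂
  have hM0 : 0 ≤ M := (abs_nonneg _).trans (hM 0)
  refine ⟨C * M, fun p => ?_⟩
  calc |rlInt T χ a f p|
      ≤ ∫ q : ℝ × ℝ, rlKernel T χ a.1 p.1 q.1 * rlKernel T χ a.2 p.2 q.2 * M := by
        rw [← Real.norm_eq_abs]
        refine norm_integral_le_of_norm_le ((h.integrable_rlKernel₂ ha₁ ha₂).mul_const M)
          (.of_forall fun r => ?_)
        rw [Real.norm_eq_abs, abs_mul, abs_of_nonneg (h.rlKernel₂_nonneg ha₁ ha₂)]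
        exact mul_le_mul_of_nonneg_left (hM r) (h.rlKernel₂_nonneg ha₁ ha₂)
    _ ≤ C * M := by
        rw [integral_mul_const]
        gcongr
        exact hC p

theorem measurable_rlInt (h : Admissible T χ) {a : ℝ × ℝ} {f : ℝ × ℝ → ℝ} (hf : Measurable f) :
    Measurable (rlInt T χ a f) :=
  (StronglyMeasurable.integral_prod_right (ν := volume)
    ((h.measurable_rlKernel₂ (a := a)).mul (hf.comp measurable_snd)).stronglyMeasurable).measurable

/-- The semigroup property `I^a I^b = I^(a+b)`. -/
theorem rlInt_rlInt (h : Admissible T χ) {a b : ℝ × ℝ} (ha₁ : 0 < a.1) (ha₂ : 0 < a.2)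
    (hb₁ : 0 < b.1) (hb₂ : 0 < b.2) {f : ℝ × ℝ → ℝ} (hf : Measurable f) {M : ℝ}
    (hM : ∀ q, |f q| ≤ M) : rlInt T χ a (rlInt T χ b f) = rlInt T χ (a + b) f := by
  ext p
  set Φ : ℝ × ℝ → ℝ × ℝ → ℝ := fun r q =>
    rlKernel T χ a.1 p.1 r.1 * rlKernel T χ a.2 p.2 r.2 *
      (rlKernel T χ b.1 r.1 q.1 * rlKernel T χ b.2 r.2 q.2 * f q) with hΦ
  have hm : Measurable (Function.uncurry Φ) := by
    refine Measurable.mul ?_ ?_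
    · exact (h.measurable_rlKernel₂ (a := a)).comp
        (f := fun z : (ℝ × ℝ) × (ℝ × ℝ) => (p, z.1)) (by fun_prop)
    · exact (h.measurable_rlKernel₂ (a := b)).mul (hf.comp measurable_snd)
  obtain ⟨C, hC⟩ := h.exists_abs_rlInt_le hb₁ hb₂ (f := fun q => |f q|) (M := M)
    (by simpa using hM)
  have hi : Integrable (Function.uncurry Φ) (volume.prod volume) := by
    rw [integrable_prod_iff hm.aestronglyMeasurable]
    refine ⟨.of_forall fun r => (h.integrable_rlKernel₂_mul hb₁ hb₂ (p := r) hf hM).const_mul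
      (rlKernel T χ a.1 p.1 r.1 * rlKernel T χ a.2 p.2 r.2), ?_⟩
    -- Fubini is justified by positivity of the kernels: the inner integral of |Φ| is the kernel
    -- times I^b|f|, and I^b|f| is bounded.
    have h1 : (fun r : ℝ × ℝ => ∫ q, ‖Function.uncurry Φ (r, q)‖) = fun r =>
        rlKernel T χ a.1 p.1 r.1 * rlKernel T χ a.2 p.2 r.2 *
          rlInt T χ b (fun q => |f q|) r := by
      ext r
      rw [rlInt, ← integral_const_mul]
      refine integral_congr_ae (.of_forall fun q => ?_)
      simp only [Function.uncurry, hΦ, Real.norm_eq_abs]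
      rw [abs_mul, abs_mul _ (f q), abs_of_nonneg (h.rlKernel₂_nonneg ha₁ ha₂),
        abs_of_nonneg (h.rlKernel₂_nonneg hb₁ hb₂)]
    rw [h1]
    exact h.integrable_rlKernel₂_mul ha₁ ha₂ (h.measurable_rlInt hf.abs) hC
  have h2 : rlInt T χ a (rlInt T χ b f) p = ∫ r, ∫ q, Φ r q := by
    refine integral_congr_ae (.of_forall fun r => ?_)
    simp only [hΦ]
    rw [integral_const_mul, rlInt]
  rw [h2, integral_integral_swap hi, rlInt]
  refine integral_congr_ae (.of_forall fun q => ?_)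
  -- With q fixed the variables separate, and each factor is a one-dimensional semigroup identity.
  have h3 : ∀ r, Φ r q = (rlKernel T χ a.1 p.1 r.1 * rlKernel T χ b.1 r.1 q.1) *
      (rlKernel T χ a.2 p.2 r.2 * rlKernel T χ b.2 r.2 q.2) * f q := fun r => by
    simp only [hΦ]
    ring
  simp only [h3]
  rw [integral_mul_const, Measure.volume_eq_prod,
    integral_prod_mul (fun r => rlKernel T χ a.1 p.1 r * rlKernel T χ b.1 r q.1)
      (fun r => rlKernel T χ a.2 p.2 r * rlKernel T χ b.2 r q.2),
    h.integral_rlKernel_mul ha₁ hb₁, h.integral_rlKernel_mul ha₂ hb₂]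
  rfl

theorem rlInt_eq_iterated (h : Admissible T χ) {a : ℝ × ℝ} (ha₁ : 0 < a.1) (ha₂ : 0 < a.2)
    {f : ℝ × ℝ → ℝ} (hf : Measurable f) {M : ℝ} (hM : ∀ q, |f q| ≤ M) (p : ℝ × ℝ) :
    rlInt T χ a f p = ∫ s, rlKernel T χ a.1 p.1 s * ∫ t, rlKernel T χ a.2 p.2 t * f (s, t) := by
  rw [rlInt, Measure.volume_eq_prod, integral_prod]
  · refine integral_congr_ae (.of_forall fun s => ?_)
    simp only
    rw [← integral_const_mul]
    simp only [mul_assoc]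
  · exact h.integrable_rlKernel₂_mul ha₁ ha₂ hf hM

/-- The order suited to `mixedDeriv`, which differentiates in the second variable first. -/
theorem rlInt_eq_iterated_symm (h : Admissible T χ) {a : ℝ × ℝ} (ha₁ : 0 < a.1) (ha₂ : 0 < a.2)
    {f : ℝ × ℝ → ℝ} (hf : Measurable f) {M : ℝ} (hM : ∀ q, |f q| ≤ M) (p : ℝ × ℝ) :
    rlInt T χ a f p = ∫ t, rlKernel T χ a.2 p.2 t * ∫ s, rlKernel T χ a.1 p.1 s * f (s, t) := by
  rw [rlInt, Measure.volume_eq_prod, integral_prod_symm]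
  · refine integral_congr_ae (.of_forall fun s => ?_)
    simp only
    rw [← integral_const_mul]
    congr 1 with t
    ring
  · exact h.integrable_rlKernel₂_mul ha₁ ha₂ hf hM

end Admissible

theorem fracInt₁_eq_integral_rlKernel (ha : a ≠ 0) (hx : x ∈ Ioo 0 T) (f : ℝ → ℝ) :
    fracInt₁ T χ a f x = ∫ s, rlKernel T χ a x s * f s := by
  have h1 : (fun s => rlKernel T χ a x s * f s) = (Ioo 0 x).indicator fun s =>
      (Real.Gamma a)⁻¹ * (dchi T χ s * (χ x - χ s) ^ (a - 1) * f s) := by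
    ext s
    by_cases hs : s ∈ Ioo 0 x
    · rw [indicator_of_mem hs, rlKernel, if_pos ⟨hs.1, hs.2, hx.2⟩, mul_assoc]
    · rw [indicator_of_notMem hs, rlKernel, if_neg fun h => hs ⟨h.1, h.2.1⟩, zero_mul]
  rw [h1, integral_indicator measurableSet_Ioo, integral_const_mul, fracInt₁, if_neg ha,
    intervalIntegral.integral_of_le hx.1.le, integral_Ioc_eq_integral_Ioo]

/-- Only values in the open square enter, so f may be replaced by a bounded measurable g agreeing
with it there; f itself may be irregular elsewhere. -/
theorem Admissible.fracInt_eq_rlInt (h : Admissible T χ) {a : ℝ × ℝ} (ha₁ : 0 < a.1)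
    (ha₂ : 0 < a.2) {f g : ℝ × ℝ → ℝ} (hg : Measurable g) {M : ℝ} (hM : ∀ q, |g q| ≤ M)
    (hfg : EqOn f g (Ioo 0 T ×ˢ Ioo 0 T)) :
    EqOn (fracInt T χ a f) (rlInt T χ a g) (Ioo 0 T ×ˢ Ioo 0 T) := by
  intro p hp
  rw [h.rlInt_eq_iterated ha₁ ha₂ hg hM, fracInt, fracInt₁_eq_integral_rlKernel ha₁.ne' hp.1]
  refine integral_congr_ae (.of_forall fun s => ?_)
  by_cases hs : 0 < s ∧ s < p.1 ∧ p.1 < T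
  · simp only
    rw [fracInt₁_eq_integral_rlKernel ha₂.ne' hp.2]
    congr 1
    refine integral_congr_ae (.of_forall fun t => ?_)
    by_cases ht : 0 < t ∧ t < p.2 ∧ p.2 < T
    · simp only
      rw [hfg ⟨⟨hs.1, hs.2.1.trans hs.2.2⟩, ⟨ht.1, ht.2.1.trans ht.2.2⟩⟩]
    · simp [rlKernel, ht]
  · simp [rlKernel, hs]

end

/-! ### Inverting the Hilfer derivative on test functions. -/

section

variable {T : ℝ} {χ : ℝ → ℝ} {a b x y s : ℝ}

theorem mixedDeriv_congr {g g' : ℝ × ℝ → ℝ} (hg : EqOn g g' (Ioo 0 T ×ˢ Ioo 0 T)) :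
    EqOn (mixedDeriv T χ g) (mixedDeriv T χ g') (Ioo 0 T ×ˢ Ioo 0 T) := by
  intro p hp
  unfold mixedDeriv
  congr 1
  refine Filter.EventuallyEq.deriv_eq ?_
  filter_upwards [Ioo_mem_nhds hp.1.1 hp.1.2] with x hx
  refine Filter.EventuallyEq.deriv_eq ?_
  filter_upwards [Ioo_mem_nhds hp.2.1 hp.2.2] with y hy
  exact hg ⟨hx, hy⟩

theorem rlKernel_one (hx : x < T) : rlKernel T χ 1 x = (Ioo 0 x).indicator (dchi T χ) := by
  ext s
  by_cases hs : s ∈ Ioo 0 x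
  · rw [indicator_of_mem hs, rlKernel, if_pos ⟨hs.1, hs.2, hx⟩]
    simp
  · rw [indicator_of_notMem hs, rlKernel, if_neg fun h => hs ⟨h.1, h.2.1⟩]

theorem integral_rlKernel_one_mul (hx : x ∈ Ioo 0 T) (g : ℝ → ℝ) :
    ∫ s, rlKernel T χ 1 x s * g s = ∫ s in (0 : ℝ)..x, dchi T χ s * g s := by
  rw [intervalIntegral.integral_of_le hx.1.le, integral_Ioc_eq_integral_Ioo,
    ← integral_indicator measurableSet_Ioo, rlKernel_one hx.2]
  simp only [indicator_mul_left]

namespace Admissible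

theorem hasDerivAt_integral_rlKernel_one_mul (h : Admissible T χ) {g : ℝ → ℝ} (hg : Measurable g)
    {M : ℝ} (hM : ∀ r, |g r| ≤ M) (hx : x ∈ Ioo 0 T) (hgx : ContinuousAt g x) :
    HasDerivAt (fun x => ∫ s, rlKernel T χ 1 x s * g s) (dchi T χ x * g x) x := by
  have hm : AEStronglyMeasurable (fun s => dchi T χ s * g s) (volume.restrict (Ioo 0 T)) :=
    ((h.continuousOn_dchi.mono Ioo_subset_Icc_self).aestronglyMeasurable measurableSet_Ioo).mul
      hg.aestronglyMeasurable
  have hi : IntervalIntegrable (fun s => dchi T χ s * g s) volume 0 x := by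
    rw [intervalIntegrable_iff_integrableOn_Ioo_of_le hx.1.le,
      ← integrable_indicator_iff measurableSet_Ioo]
    have := h.integrable_rlKernel_mul one_pos hg hM (x := x)
    rw [rlKernel_one hx.2] at this
    exact this.congr (.of_forall fun r => (indicator_mul_left _ _ _).symm)
  have h1 := intervalIntegral.integral_hasDerivAt_right hi
    ⟨Ioo 0 T, Ioo_mem_nhds hx.1 hx.2, hm⟩
    ((h.continuousOn_dchi.continuousAt (Icc_mem_nhds hx.1 hx.2)).mul hgx)
  refine h1.congr_of_eventuallyEq ?_
  filter_upwards [Ioo_mem_nhds hx.1 hx.2] with y hy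
  exact integral_rlKernel_one_mul hy g

/-- The fundamental theorem of calculus, in y and then in x. Separate continuity suffices:
continuity in y survives the integration in x by dominated convergence. -/
theorem mixedDeriv_rlInt_one (h : Admissible T χ) {f : ℝ × ℝ → ℝ} (hf : Measurable f)
    {M : ℝ} (hM : ∀ q, |f q| ≤ M)
    (hc₁ : ∀ x ∈ Ioo 0 T, ∀ y ∈ Ioo 0 T, ContinuousAt (fun x => f (x, y)) x)
    (hc₂ : ∀ x ∈ Ioo 0 T, ∀ y ∈ Ioo 0 T, ContinuousAt (fun y => f (x, y)) y) :
    EqOn (mixedDeriv T χ (rlInt T χ (1, 1) f)) f (Ioo 0 T ×ˢ Ioo 0 T) := by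
  rintro ⟨x, y⟩ ⟨hx, hy⟩
  simp only at hx hy
  obtain ⟨C, -, hC⟩ := h.exists_integral_rlKernel_le one_pos
  have hinner : ∀ x', Measurable fun t => ∫ s, rlKernel T χ 1 x' s * f (s, t) := fun x' =>
    (StronglyMeasurable.integral_prod_left (μ := volume)
      (((h.measurable_rlKernel_right (a := 1) (x := x')).comp measurable_fst).mul
        hf).stronglyMeasurable).measurable
  have hcont : ∀ x', ContinuousAt (fun t => ∫ s, rlKernel T χ 1 x' s * f (s, t)) y := by
    intro x'
    refine continuousAt_of_dominated (bound := fun s => rlKernel T χ 1 x' s * M)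
      (.of_forall fun t => (h.measurable_rlKernel_right.mul
        (hf.comp measurable_prodMk_right)).aestronglyMeasurable)
      (.of_forall fun t => .of_forall fun s => ?_)
      ((h.integrable_rlKernel one_pos).mul_const M) (.of_forall fun s => ?_)
    · rw [Real.norm_eq_abs, abs_mul, abs_of_nonneg (h.rlKernel_nonneg one_pos)]
      exact mul_le_mul_of_nonneg_left (hM _) (h.rlKernel_nonneg one_pos)
    · by_cases hs : 0 < s ∧ s < x' ∧ x' < T
      · exact continuousAt_const.mul (hc₂ s ⟨hs.1, hs.2.1.trans hs.2.2⟩ y hy)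
      · simp only [rlKernel, if_neg hs, zero_mul]
        exact continuousAt_const
  have hy' : ∀ x', deriv (fun y => rlInt T χ (1, 1) f (x', y)) y =
      dchi T χ y * ∫ s, rlKernel T χ 1 x' s * f (s, y) := by
    intro x'
    have h1 : (fun y => rlInt T χ (1, 1) f (x', y)) = fun y =>
        ∫ t, rlKernel T χ 1 y t * ∫ s, rlKernel T χ 1 x' s * f (s, t) := by
      ext y
      exact h.rlInt_eq_iterated_symm one_pos one_pos hf hM _
    rw [h1]
    exact (h.hasDerivAt_integral_rlKernel_one_mul (hinner x')
      (fun t => h.abs_integral_rlKernel_mul_le one_pos (fun s => hM (s, t)) (hC x')) hy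
      (hcont x')).deriv
  have hx' : deriv (fun x' => dchi T χ y * ∫ s, rlKernel T χ 1 x' s * f (s, y)) x =
      dchi T χ y * (dchi T χ x * f (x, y)) :=
    ((h.hasDerivAt_integral_rlKernel_one_mul (g := fun s => f (s, y))
      (hf.comp measurable_prodMk_right) (fun s => hM _) hx (hc₁ x hx y hy)).const_mul _).deriv
  simp only [mixedDeriv, hy', hx']
  have h1 := (h.dchi_pos x (Ioo_subset_Icc_self hx)).ne'
  have h2 := (h.dchi_pos y (Ioo_subset_Icc_self hy)).ne'
  field_simp

theorem continuousAt_rlInt_fst (h : Admissible T χ) {a : ℝ × ℝ} (ha₁ : 0 < a.1) (ha₁' : a.1 ≤ 1)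
    (ha₂ : 0 < a.2) {f : ℝ × ℝ → ℝ} (hf : Measurable f) {M : ℝ} (hM : ∀ q, |f q| ≤ M)
    (hx : x ∈ Ioo 0 T) (y : ℝ) : ContinuousAt (fun x => rlInt T χ a f (x, y)) x := by
  obtain ⟨C, -, hC⟩ := h.exists_integral_rlKernel_le ha₂
  simp only [h.rlInt_eq_iterated ha₁ ha₂ hf hM]
  refine h.continuousAt_integral_rlKernel_mul ha₁ ha₁' ?_
    (fun s => h.abs_integral_rlKernel_mul_le ha₂ (fun t => hM (s, t)) (hC y)) hx
  exact (StronglyMeasurable.integral_prod_right (ν := volume)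
    (((h.measurable_rlKernel_right (a := a.2) (x := y)).comp measurable_snd).mul
      hf).stronglyMeasurable).measurable

theorem continuousAt_rlInt_snd (h : Admissible T χ) {a : ℝ × ℝ} (ha₁ : 0 < a.1)
    (ha₂ : 0 < a.2) (ha₂' : a.2 ≤ 1) {f : ℝ × ℝ → ℝ} (hf : Measurable f) {M : ℝ}
    (hM : ∀ q, |f q| ≤ M) (hy : y ∈ Ioo 0 T) (x : ℝ) :
    ContinuousAt (fun y => rlInt T χ a f (x, y)) y := by
  obtain ⟨C, -, hC⟩ := h.exists_integral_rlKernel_le ha₁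
  simp only [h.rlInt_eq_iterated_symm ha₁ ha₂ hf hM]
  refine h.continuousAt_integral_rlKernel_mul ha₂ ha₂' ?_
    (fun t => h.abs_integral_rlKernel_mul_le ha₁ (fun s => hM (s, t)) (hC x)) hy
  exact (StronglyMeasurable.integral_prod_left (μ := volume)
    (((h.measurable_rlKernel_right (a := a.1) (x := x)).comp measurable_fst).mul
      hf).stronglyMeasurable).measurable

end Admissible

theorem _root_.ContDiff.fderiv_apply_const {f : ℝ × ℝ → ℝ} (hf : ContDiff ℝ (⊤ : ℕ∞) f)
    (v : ℝ × ℝ) : ContDiff ℝ (⊤ : ℕ∞) fun p => fderiv ℝ f p v :=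
  (hf.fderiv_right (m := ((⊤ : ℕ∞) : WithTop ℕ∞)) (by simp)).clm_apply contDiff_const

theorem hasDerivAt_snd_of_contDiff {f : ℝ × ℝ → ℝ} (hf : ContDiff ℝ (⊤ : ℕ∞) f) (x y : ℝ) :
    HasDerivAt (fun y => f (x, y)) (fderiv ℝ f (x, y) (0, 1)) y :=
  ((hf.differentiable (by simp) (x, y)).hasFDerivAt.comp_hasDerivAt y
    ((hasDerivAt_const y x).prodMk (hasDerivAt_id y)))

theorem hasDerivAt_fst_of_contDiff {f : ℝ × ℝ → ℝ} (hf : ContDiff ℝ (⊤ : ℕ∞) f) (x y : ℝ) :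
    HasDerivAt (fun x => f (x, y)) (fderiv ℝ f (x, y) (1, 0)) x :=
  ((hf.differentiable (by simp) (x, y)).hasFDerivAt.comp_hasDerivAt x
    ((hasDerivAt_id x).prodMk (hasDerivAt_const x y)))

/-- Integrating ψ_xy back from the axes loses nothing, because ψ and ψ_y vanish there; the weights
χ' in the order-one kernels cancel the division by χ'χ'. The witness is cut off to the open square
to be globally bounded and measurable. -/
theorem IsTestFunction.exists_eq_rlInt_one (h : Admissible T χ) {ψ : ℝ × ℝ → ℝ}
    (hψ : IsTestFunction T ψ) : ∃ w : ℝ × ℝ → ℝ, Measurable w ∧ (∃ M, ∀ q, |w q| ≤ M) ∧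
      EqOn (mixedDeriv T χ ψ) w (Ioo 0 T ×ˢ Ioo 0 T) ∧
      EqOn ψ (rlInt T χ (1, 1) w) (Ioo 0 T ×ˢ Ioo 0 T) := by
  obtain ⟨hsm, -, hsupp⟩ := hψ
  set U : Set (ℝ × ℝ) := Ioo 0 T ×ˢ Ioo 0 T with hU
  set ψ₂ : ℝ × ℝ → ℝ := fun p => fderiv ℝ ψ p (0, 1) with hψ₂
  have hsm₂ : ContDiff ℝ (⊤ : ℕ∞) ψ₂ := hsm.fderiv_apply_const _
  set ψ₁₂ : ℝ × ℝ → ℝ := fun p => fderiv ℝ ψ₂ p (1, 0) with hψ₁₂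
  have hcont : Continuous ψ₁₂ := (hsm₂.fderiv_apply_const _).continuous
  have hmix : ∀ p, mixedDeriv T χ ψ p = (dchi T χ p.1 * dchi T χ p.2)⁻¹ * ψ₁₂ p := by
    intro p
    simp only [mixedDeriv, (hasDerivAt_snd_of_contDiff hsm _ _).deriv]
    rw [(hasDerivAt_fst_of_contDiff hsm₂ p.1 p.2).deriv]
  have hUsub : U ⊆ Icc 0 T ×ˢ Icc 0 T := prod_mono Ioo_subset_Icc_self Ioo_subset_Icc_self
  -- Continuity up to the boundary, from χ' > 0 on the closed interval, provides the bound.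
  have hmc : ContinuousOn (mixedDeriv T χ ψ) (Icc 0 T ×ˢ Icc 0 T) := by
    rw [show mixedDeriv T χ ψ = fun p => (dchi T χ p.1 * dchi T χ p.2)⁻¹ * ψ₁₂ p from funext hmix]
    refine ContinuousOn.mul (ContinuousOn.inv₀ ?_ ?_) hcont.continuousOn
    · exact (h.continuousOn_dchi.comp continuousOn_fst fun p hp => hp.1).mul
        (h.continuousOn_dchi.comp continuousOn_snd fun p hp => hp.2)
    · exact fun p hp => mul_ne_zero (h.dchi_pos _ hp.1).ne' (h.dchi_pos _ hp.2).ne'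
  have hUm : MeasurableSet U := measurableSet_Ioo.prod measurableSet_Ioo
  have hwm : Measurable (U.indicator (mixedDeriv T χ ψ)) := by
    classical
    rw [← piecewise_eq_indicator]
    exact (hmc.mono hUsub).measurable_piecewise continuousOn_const hUm
  have hwb : ∃ M, ∀ q, |U.indicator (mixedDeriv T χ ψ) q| ≤ M := by
    obtain ⟨M, hM⟩ := (isCompact_Icc.prod isCompact_Icc).exists_bound_of_continuousOn hmc
    refine ⟨max M 0, fun q => ?_⟩
    by_cases hq : q ∈ U
    · rw [indicator_of_mem hq]
      exact (hM q (hUsub hq)).trans (le_max_left _ _)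
    · rw [indicator_of_notMem hq, abs_zero]
      exact le_max_right _ _
  obtain ⟨M, hM⟩ := hwb
  have hzero : ∀ p, p ∉ U → ψ p = 0 ∧ ψ₂ p = 0 := fun p hp => by
    have h1 : p ∉ tsupport ψ := fun h => hp (hsupp h)
    refine ⟨image_eq_zero_of_notMem_tsupport h1, ?_⟩
    have : fderiv ℝ ψ p = 0 := by
      by_contra hne
      exact h1 (support_fderiv_subset ℝ hne)
    simp [hψ₂, this]
  refine ⟨U.indicator (mixedDeriv T χ ψ), hwm, ⟨M, hM⟩,
    fun p hp => (indicator_of_mem hp _).symm, ?_⟩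
  rintro ⟨x, y⟩ ⟨hx, hy⟩
  simp only at hx hy
  have hin : ∀ t ∈ Ioo 0 T, ∫ s, rlKernel T χ 1 x s * U.indicator (mixedDeriv T χ ψ) (s, t) =
      (dchi T χ t)⁻¹ * ψ₂ (x, t) := by
    intro t ht
    have h1 : ∀ s, rlKernel T χ 1 x s * U.indicator (mixedDeriv T χ ψ) (s, t) =
        (Ioo 0 x).indicator (fun s => (dchi T χ t)⁻¹ * ψ₁₂ (s, t)) s := by
      intro s
      rw [rlKernel_one hx.2]
      by_cases hs : s ∈ Ioo 0 x
      · have hsT : s ∈ Ioo 0 T := ⟨hs.1, hs.2.trans hx.2⟩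
        rw [indicator_of_mem hs, indicator_of_mem hs, indicator_of_mem (show (s, t) ∈ U from ⟨hsT, ht⟩), hmix]
        have := (h.dchi_pos s (Ioo_subset_Icc_self hsT)).ne'
        simp only
        field_simp
      · rw [indicator_of_notMem hs, indicator_of_notMem hs, zero_mul]
    simp only [h1]
    rw [integral_indicator measurableSet_Ioo, integral_const_mul, ← integral_Ioc_eq_integral_Ioo,
      ← intervalIntegral.integral_of_le hx.1.le,
      intervalIntegral.integral_eq_sub_of_hasDerivAt
        (fun s _ => hasDerivAt_fst_of_contDiff hsm₂ s t)
        ((hcont.comp (by fun_prop : Continuous fun s : ℝ => (s, t))).intervalIntegrable _ _),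
      (hzero (0, t) fun h => lt_irrefl _ h.1.1).2, sub_zero]
  have hout : ∀ t, rlKernel T χ 1 y t *
      ∫ s, rlKernel T χ 1 x s * U.indicator (mixedDeriv T χ ψ) (s, t) =
      (Ioo 0 y).indicator (fun t => ψ₂ (x, t)) t := by
    intro t
    rw [rlKernel_one hy.2]
    by_cases ht : t ∈ Ioo 0 y
    · have htT : t ∈ Ioo 0 T := ⟨ht.1, ht.2.trans hy.2⟩
      rw [indicator_of_mem ht, indicator_of_mem ht, hin t htT]
      have := (h.dchi_pos t (Ioo_subset_Icc_self htT)).ne'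
      field_simp
    · rw [indicator_of_notMem ht, indicator_of_notMem ht, zero_mul]
  rw [h.rlInt_eq_iterated_symm one_pos one_pos hwm hM]
  simp only [hout]
  rw [integral_indicator measurableSet_Ioo, ← integral_Ioc_eq_integral_Ioo,
    ← intervalIntegral.integral_of_le hy.1.le,
    intervalIntegral.integral_eq_sub_of_hasDerivAt
      (fun t _ => hasDerivAt_snd_of_contDiff hsm x t)
      ((hsm₂.continuous.comp (by fun_prop : Continuous fun t : ℝ => (x, t))).intervalIntegrable
        _ _),
    (hzero (x, 0) fun h => lt_irrefl _ h.2.1).1, sub_zero]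

theorem fracInt_zero (f : ℝ × ℝ → ℝ) : fracInt T χ (0, 0) f = f := by
  ext p
  simp [fracInt, fracInt₁]

/-- A test function is the `χ`-Riemann-Liouville integral of its `χ`-Hilfer derivative. -/
theorem IsTestFunction.exists_eq_rlInt_hilferDeriv (h : Admissible T χ) {ψ : ℝ × ℝ → ℝ}
    (hψ : IsTestFunction T ψ) {α : ℝ × ℝ} (hα₁ : 0 < α.1) (hα₁' : α.1 < 1) (hα₂ : 0 < α.2)
    (hα₂' : α.2 < 1) {β : ℝ} (hβ0 : 0 ≤ β) (hβ1 : β ≤ 1) :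
    ∃ g : ℝ × ℝ → ℝ, EqOn (hilferDeriv T χ α β ψ) g (Ioo 0 T ×ˢ Ioo 0 T) ∧
      EqOn ψ (rlInt T χ α g) (Ioo 0 T ×ˢ Ioo 0 T) := by
  obtain ⟨w, hwm, ⟨M, hM⟩, hmix, hrep⟩ := hψ.exists_eq_rlInt_one h
  have hγ₁ : 0 < 1 - α.1 := sub_pos.2 hα₁'
  have hγ₂ : 0 < 1 - α.2 := sub_pos.2 hα₂'
  obtain ⟨M₁, hM₁⟩ := h.exists_abs_rlInt_le (a := (1, 1)) one_pos one_pos hM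
  have hw₁ : Measurable (rlInt T χ (1, 1) w) := h.measurable_rlInt hwm
  -- Since ψ = I^1 w, one has I^κ ψ = I^1 I^κ w, and the mixed derivative removes I^1.
  have hder : ∀ κ : ℝ × ℝ, 0 < κ.1 → κ.1 ≤ 1 → 0 < κ.2 → κ.2 ≤ 1 →
      EqOn (mixedDeriv T χ (fracInt T χ κ ψ)) (rlInt T χ κ w) (Ioo 0 T ×ˢ Ioo 0 T) := by
    intro κ h1 h1' h2 h2'
    have e1 := h.fracInt_eq_rlInt h1 h2 hw₁ hM₁ hrep
    rw [h.rlInt_rlInt h1 h2 one_pos one_pos hwm hM, add_comm,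
      ← h.rlInt_rlInt one_pos one_pos h1 h2 hwm hM] at e1
    obtain ⟨M₂, hM₂⟩ := h.exists_abs_rlInt_le h1 h2 hM
    exact (mixedDeriv_congr e1).trans (h.mixedDeriv_rlInt_one (h.measurable_rlInt hwm) hM₂
      (fun x hx y _ => h.continuousAt_rlInt_fst h1 h1' h2 hwm hM hx y)
      (fun x _ y hy => h.continuousAt_rlInt_snd h1 h2 h2' hwm hM hy x))
  -- The witness I^(1-α) w does not depend on β: the orders β(1-α) and (1-β)(1-α) add up to 1-α. The
  -- cases β = 0 and β = 1 are separate because order zero is the identity, without a kernel.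
  refine ⟨rlInt T χ (1 - α.1, 1 - α.2) w, ?_, ?_⟩
  · unfold hilferDeriv
    rcases hβ0.eq_or_lt with rfl | hβ0
    · simp only [zero_mul, sub_zero, one_mul]
      rw [fracInt_zero]
      exact hder (1 - α.1, 1 - α.2) hγ₁ (by simp only; linarith) hγ₂ (by simp only; linarith)
    rcases hβ1.eq_or_lt with rfl | hβ1
    · simp only [sub_self, zero_mul, one_mul]
      rw [fracInt_zero]
      exact h.fracInt_eq_rlInt hγ₁ hγ₂ hwm hM hmix
    have hβ1' := sub_pos.2 hβ1
    have p1 := mul_pos hβ1' hγ₁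
    have p2 := mul_pos hβ1' hγ₂
    obtain ⟨M₂, hM₂⟩ := h.exists_abs_rlInt_le
      (a := ((1 - β) * (1 - α.1), (1 - β) * (1 - α.2))) p1 p2 hM
    have e1 := h.fracInt_eq_rlInt (a := (β * (1 - α.1), β * (1 - α.2))) (mul_pos hβ0 hγ₁)
      (mul_pos hβ0 hγ₂) (h.measurable_rlInt hwm) hM₂
      (hder ((1 - β) * (1 - α.1), (1 - β) * (1 - α.2)) p1 (by simp only; nlinarith) p2
        (by simp only; nlinarith))
    rw [h.rlInt_rlInt (mul_pos hβ0 hγ₁) (mul_pos hβ0 hγ₂) p1 p2 hwm hM, Prod.mk_add_mk,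
      ← add_mul, ← add_mul, add_sub_cancel, one_mul, one_mul] at e1
    exact e1
  · rw [h.rlInt_rlInt hα₁ hα₂ hγ₁ hγ₂ hwm hM]
    have : α + (1 - α.1, 1 - α.2) = (1, 1) := by
      ext <;> simp
    rwa [this]

end

/-! ### The embedding into L^∞. -/

section

variable {T : ℝ} {χ : ℝ → ℝ} {a b x y s : ℝ}

theorem measurableSet_square : MeasurableSet (square T) := measurableSet_Icc.prod measurableSet_Icc

theorem isCompact_square : IsCompact (square T) := isCompact_Icc.prod isCompact_Icc

theorem Ioo_prod_subset_square : Ioo 0 T ×ˢ Ioo 0 T ⊆ square T :=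
  prod_mono Ioo_subset_Icc_self Ioo_subset_Icc_self

theorem volume_square_lt_top : volume (square T) < ∞ := isCompact_square.measure_lt_top

namespace Admissible

/-- The q-th power has singular exponent (a-1)q, that of the kernel of order (a-1)q + 1; the surplus
χ'^(q-1) is bounded. So L^q integrability reduces to positivity of that order. -/
theorem exists_rlKernel_rpow_le (h : Admissible T χ) (ha : 0 < a) {q : ℝ} (hq : 1 < q)
    (hb : 0 < (a - 1) * q + 1) :
    ∃ C, 0 ≤ C ∧ ∀ x s, rlKernel T χ a x s ^ q ≤ C * rlKernel T χ ((a - 1) * q + 1) x s := by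
  obtain ⟨M, hM⟩ := isCompact_Icc.exists_bound_of_continuousOn h.continuousOn_dchi
  have hM0 : 0 ≤ M := (norm_nonneg _).trans (hM 0 ⟨le_rfl, h.pos.le⟩)
  have hΓa := Real.Gamma_pos_of_pos ha
  have hΓb := Real.Gamma_pos_of_pos hb
  refine ⟨(Real.Gamma a)⁻¹ ^ q * M ^ (q - 1) * Real.Gamma ((a - 1) * q + 1), by positivity,
    fun x s => ?_⟩
  by_cases hc : 0 < s ∧ s < x ∧ x < T
  · have hsT : s ∈ Icc 0 T := ⟨hc.1.le, (hc.2.1.trans hc.2.2).le⟩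
    have hd := h.dchi_pos s hsT
    have hD := sub_pos.2 (h.strictMonoOn hsT ⟨(hc.1.trans hc.2.1).le, hc.2.2.le⟩ hc.2.1)
    have hdM : dchi T χ s ≤ M := (le_abs_self _).trans (hM s hsT)
    rw [rlKernel, rlKernel, if_pos hc, if_pos hc, add_sub_cancel_right,
      Real.mul_rpow (by positivity) (by positivity), Real.mul_rpow hd.le (by positivity),
      ← Real.rpow_mul hD.le]
    have h1 : dchi T χ s ^ q = dchi T χ s ^ (q - 1) * dchi T χ s := by
      rw [← Real.rpow_add_one hd.ne', sub_add_cancel]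
    have h2 : dchi T χ s ^ (q - 1) ≤ M ^ (q - 1) :=
      Real.rpow_le_rpow hd.le hdM (by linarith)
    rw [h1]
    calc (Real.Gamma a)⁻¹ ^ q * (dchi T χ s ^ (q - 1) * dchi T χ s * (χ x - χ s) ^ ((a - 1) * q))
        ≤ (Real.Gamma a)⁻¹ ^ q * (M ^ (q - 1) * dchi T χ s * (χ x - χ s) ^ ((a - 1) * q)) := by
          gcongr
      _ = _ := by
          generalize Real.Gamma ((a - 1) * q + 1) = G at hΓb ⊢
          field_simp
  · rw [rlKernel, rlKernel, if_neg hc, if_neg hc, Real.zero_rpow (by linarith), mul_zero]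

theorem exists_lintegral_rlKernel₂_rpow_le (h : Admissible T χ) {a : ℝ × ℝ} (ha₁ : 0 < a.1)
    (ha₂ : 0 < a.2) {q : ℝ} (hq : 1 < q) (hb₁ : 0 < (a.1 - 1) * q + 1)
    (hb₂ : 0 < (a.2 - 1) * q + 1) : ∃ C : ℝ, 0 ≤ C ∧ ∀ p : ℝ × ℝ,
      ∫⁻ z : ℝ × ℝ, ENNReal.ofReal ((rlKernel T χ a.1 p.1 z.1 * rlKernel T χ a.2 p.2 z.2) ^ q) ≤
        ENNReal.ofReal C := by
  obtain ⟨C₁, h₁, hC₁⟩ := h.exists_rlKernel_rpow_le ha₁ hq hb₁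
  obtain ⟨C₂, h₂, hC₂⟩ := h.exists_rlKernel_rpow_le ha₂ hq hb₂
  set b : ℝ × ℝ := ((a.1 - 1) * q + 1, (a.2 - 1) * q + 1) with hb
  obtain ⟨C, h₀, hC⟩ := h.exists_integral_rlKernel₂_le (a := b) hb₁ hb₂
  refine ⟨C₁ * C₂ * C, by positivity, fun p => ?_⟩
  calc ∫⁻ z : ℝ × ℝ, ENNReal.ofReal ((rlKernel T χ a.1 p.1 z.1 * rlKernel T χ a.2 p.2 z.2) ^ q)
      ≤ ∫⁻ z : ℝ × ℝ, ENNReal.ofReal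
          (C₁ * C₂ * (rlKernel T χ b.1 p.1 z.1 * rlKernel T χ b.2 p.2 z.2)) := by
        refine lintegral_mono fun z => ENNReal.ofReal_le_ofReal ?_
        rw [Real.mul_rpow (h.rlKernel_nonneg ha₁) (h.rlKernel_nonneg ha₂)]
        have n1 := h.rlKernel_nonneg hb₁ (x := p.1) (s := z.1)
        calc _ ≤ (C₁ * rlKernel T χ b.1 p.1 z.1) * (C₂ * rlKernel T χ b.2 p.2 z.2) :=
              mul_le_mul (hC₁ _ _) (hC₂ _ _) (Real.rpow_nonneg (h.rlKernel_nonneg ha₂) _)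
                (mul_nonneg h₁ n1)
          _ = _ := by ring
    _ = ENNReal.ofReal (∫ z : ℝ × ℝ,
          C₁ * C₂ * (rlKernel T χ b.1 p.1 z.1 * rlKernel T χ b.2 p.2 z.2)) :=
        (ofReal_integral_eq_lintegral_ofReal ((h.integrable_rlKernel₂ hb₁ hb₂).const_mul _)
          (.of_forall fun z => mul_nonneg (by positivity) (h.rlKernel₂_nonneg hb₁ hb₂))).symm
    _ ≤ _ := by
        rw [integral_const_mul]
        gcongr
        exact hC p

end Admissible

/-- Represent ψ = I^α(Dψ) and use Young pointwise, K v ≤ K^q + v^p ≤ K^q + 1 + v^γ, with v = |Dψ|/k;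
no Hölder inequality for variable exponents is needed. The modular bound is 2 rather than 1 to leave
room for approximation. -/
theorem IsTestFunction.exists_bound (h : Admissible T χ) {α : ℝ × ℝ} {β : ℝ} {γ : ℝ × ℝ → ℝ}
    {p : ℝ} (hp : 1 < p) (hpγ : ∀ ξ ∈ square T, p ≤ γ ξ)
    (hα₁ : 1 / p < α.1) (hα₁' : α.1 < 1) (hα₂ : 1 / p < α.2) (hα₂' : α.2 < 1)
    (hβ0 : 0 ≤ β) (hβ1 : β ≤ 1) :
    ∃ C : ℝ, 0 < C ∧ ∀ ψ, IsTestFunction T ψ → ∀ k : ℝ, 0 < k →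
      ∫⁻ ξ in square T, ENNReal.ofReal (|hilferDeriv T χ α β ψ ξ / k| ^ γ ξ) ≤ 2 →
      ∀ z, |ψ z| ≤ C * k := by
  have hp0 : 0 < 1 / p := by positivity
  have hα₁0 := hp0.trans hα₁
  have hα₂0 := hp0.trans hα₂
  set q := p.conjExponent with hq
  have hpq : p.HolderConjugate q := Real.HolderConjugate.conjExponent hp
  have hq1 : 1 < q := hpq.symm.lt
  -- The expression increases in a and vanishes exactly at a = 1/p, by conjugacy.
  have hexp : ∀ a : ℝ, 1 / p < a → 0 < (a - 1) * q + 1 := fun a ha => by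
    have h1 : (1 / p - 1) * q + 1 = 0 := by
      have := hpq.inv_add_inv_eq_one
      have h2 := hpq.symm.pos.ne'
      rw [show 1 / p - 1 = -q⁻¹ by rw [one_div]; linarith]
      field_simp
      ring
    nlinarith [mul_pos (sub_pos.2 ha) hpq.symm.pos]
  obtain ⟨C, hC0, hC⟩ := h.exists_lintegral_rlKernel₂_rpow_le hα₁0 hα₂0 hq1 (hexp _ hα₁)
    (hexp _ hα₂)
  set V := (volume (square T)).toReal with hV
  have hV0 : 0 ≤ V := ENNReal.toReal_nonneg
  refine ⟨C + (V + 2), by positivity, fun ψ hψ k hk hle z => ?_⟩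
  by_cases hz : z ∈ Ioo 0 T ×ˢ Ioo 0 T
  swap
  · rw [image_eq_zero_of_notMem_tsupport fun hz' => hz (hψ.2.2 hz'), abs_zero]
    positivity
  obtain ⟨g, hg, hrep⟩ := hψ.exists_eq_rlInt_hilferDeriv h hα₁0 hα₁' hα₂0 hα₂' hβ0 hβ1
  rw [← div_le_iff₀ hk]
  have hUm : MeasurableSet (Ioo 0 T ×ˢ Ioo 0 T) := measurableSet_Ioo.prod measurableSet_Ioo
  have hm : Measurable fun w : ℝ × ℝ => ENNReal.ofReal
      ((rlKernel T χ α.1 z.1 w.1 * rlKernel T χ α.2 z.2 w.2) ^ q) :=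
    ((h.measurable_rlKernel₂.comp (f := fun w => (z, w)) (by fun_prop)).pow_const q).ennreal_ofReal
  have key : ENNReal.ofReal (|ψ z| / k) ≤ ENNReal.ofReal (C + (V + 2)) := by
    calc ENNReal.ofReal (|ψ z| / k)
        = ‖∫ w : ℝ × ℝ, rlKernel T χ α.1 z.1 w.1 * rlKernel T χ α.2 z.2 w.2 * g w / k‖ₑ := by
          rw [integral_div, ← rlInt, ← hrep hz, Real.enorm_eq_ofReal_abs, abs_div, abs_of_pos hk]
      _ ≤ ∫⁻ w : ℝ × ℝ, ‖rlKernel T χ α.1 z.1 w.1 * rlKernel T χ α.2 z.2 w.2 * g w / k‖ₑ :=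
          enorm_integral_le_lintegral_enorm _
      _ ≤ ∫⁻ w : ℝ × ℝ, (ENNReal.ofReal
            ((rlKernel T χ α.1 z.1 w.1 * rlKernel T χ α.2 z.2 w.2) ^ q) +
            (Ioo 0 T ×ˢ Ioo 0 T).indicator (fun ξ => 1 +
              ENNReal.ofReal (|hilferDeriv T χ α β ψ ξ / k| ^ γ ξ)) w) := by
          refine lintegral_mono fun w => ?_
          by_cases hw : w ∈ Ioo 0 T ×ˢ Ioo 0 T
          · rw [indicator_of_mem hw, Real.enorm_eq_ofReal_abs, ← ENNReal.ofReal_one,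
              ← ENNReal.ofReal_add zero_le_one (by positivity),
              ← ENNReal.ofReal_add (Real.rpow_nonneg (h.rlKernel₂_nonneg hα₁0 hα₂0) _)
                (by positivity)]
            refine ENNReal.ofReal_le_ofReal ?_
            rw [mul_div_assoc, abs_mul, abs_of_nonneg (h.rlKernel₂_nonneg hα₁0 hα₂0), ← hg hw]
            have hK := h.rlKernel₂_nonneg hα₁0 hα₂0 (p := z) (q := w)
            set K := rlKernel T χ α.1 z.1 w.1 * rlKernel T χ α.2 z.2 w.2
            set v := |hilferDeriv T χ α β ψ w / k| with hv
            have hv0 : 0 ≤ v := abs_nonneg _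
            have y1 := Real.young_inequality_of_nonneg hK hv0 hpq.symm
            have y2 : K ^ q / q ≤ K ^ q := div_le_self (Real.rpow_nonneg hK _) hq1.le
            have y3 : v ^ p / p ≤ v ^ p := div_le_self (Real.rpow_nonneg hv0 _) hp.le
            have y4 : v ^ p ≤ 1 + v ^ γ w := by
              rcases le_total v 1 with hv1 | hv1
              · have := Real.rpow_le_one hv0 hv1 (by linarith : 0 ≤ p)
                have := Real.rpow_nonneg hv0 (γ w)
                linarith
              · have := Real.rpow_le_rpow_of_exponent_le hv1
                  (hpγ w (Ioo_prod_subset_square hw))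
                linarith
            linarith
          · have : rlKernel T χ α.1 z.1 w.1 * rlKernel T χ α.2 z.2 w.2 = 0 := by
              by_contra hne
              have h1 := left_ne_zero_of_mul hne
              have h2 := right_ne_zero_of_mul hne
              simp only [rlKernel, ne_eq, ite_eq_right_iff, not_forall] at h1 h2
              obtain ⟨h1, -⟩ := h1
              obtain ⟨h2, -⟩ := h2
              exact hw ⟨⟨h1.1, h1.2.1.trans h1.2.2⟩, ⟨h2.1, h2.2.1.trans h2.2.2⟩⟩
            simp [this]
      _ = (∫⁻ w : ℝ × ℝ, ENNReal.ofReal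
            ((rlKernel T χ α.1 z.1 w.1 * rlKernel T χ α.2 z.2 w.2) ^ q)) +
            ∫⁻ ξ in Ioo 0 T ×ˢ Ioo 0 T, (1 +
              ENNReal.ofReal (|hilferDeriv T χ α β ψ ξ / k| ^ γ ξ)) := by
          rw [lintegral_add_left hm, lintegral_indicator hUm]
      _ ≤ ENNReal.ofReal C + ∫⁻ ξ in square T, (1 +
              ENNReal.ofReal (|hilferDeriv T χ α β ψ ξ / k| ^ γ ξ)) :=
          add_le_add (hC z) (lintegral_mono_set Ioo_prod_subset_square)
      _ ≤ ENNReal.ofReal C + (ENNReal.ofReal V + ENNReal.ofReal 2) := by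
          rw [lintegral_add_left measurable_const, setLIntegral_one, hV,
            ENNReal.ofReal_toReal volume_square_lt_top.ne, ENNReal.ofReal_ofNat]
          gcongr
      _ = _ := by
          rw [ENNReal.ofReal_add hC0 (by positivity), ENNReal.ofReal_add hV0 zero_le_two]
  exact (ENNReal.ofReal_le_ofReal_iff (by positivity)).1 key

theorem aemeasurable_abs_rpow {γ v : ℝ × ℝ → ℝ} (hγ : ContinuousOn γ (square T))
    (hv : AEStronglyMeasurable v (volume.restrict (square T))) :
    AEMeasurable (fun ξ => |v ξ| ^ γ ξ) (volume.restrict (square T)) :=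
  (continuous_abs.measurable.comp_aemeasurable hv.aemeasurable).pow
    (hγ.aemeasurable measurableSet_square)

/-- The embedding of the fractional derivative space into `L^∞`. -/
theorem exists_ae_bound_of_mem_hilferSpace (h : Admissible T χ) {α : ℝ × ℝ} {β : ℝ}
    {γ : ℝ × ℝ → ℝ} (hγ : ContinuousOn γ (square T))
    {p : ℝ} (hp : 1 < p) (hpγ : ∀ ξ ∈ square T, p ≤ γ ξ)
    (hα₁ : 1 / p < α.1) (hα₁' : α.1 < 1) (hα₂ : 1 / p < α.2) (hα₂' : α.2 < 1)
    (hβ0 : 0 ≤ β) (hβ1 : β ≤ 1) :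
    ∃ C : ℝ, 0 < C ∧ ∀ u ∈ hilferSpace T χ α β γ, ∀ k : ℝ, 0 < k →
      ∫⁻ ξ in square T, ENNReal.ofReal (|u.2 ξ / k| ^ γ ξ) ≤ 1 →
      ∀ᵐ ξ ∂volume.restrict (square T), |u.1 ξ| ≤ C * k := by
  obtain ⟨C, hC0, hC⟩ := IsTestFunction.exists_bound h (β := β) hp hpγ hα₁ hα₁' hα₂ hα₂' hβ0 hβ1
  refine ⟨2 * C, by positivity, fun u ⟨hu₁, hu₂, happ⟩ k hk hle => ?_⟩
  have hstep : ∀ δ : ℝ, 0 < δ →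
      ∀ᵐ ξ ∂volume.restrict (square T), |u.1 ξ| ≤ 2 * C * k + δ := by
    intro δ hδ
    rw [ae_iff, ← nonpos_iff_eq_zero]
    refine ENNReal.le_of_forall_pos_le_add fun ε hε _ => ?_
    rw [zero_add]
    -- The three entries of the accuracy k': k' < k lets Dψ/(2k) be compared with u.2/k and the
    -- error over k'; k' < δ makes δ/k' ≥ 1, so that powers with exponent at least 1 only enlarge
    -- it; k' < εδ makes the Chebyshev bound k'/δ less than ε.
    obtain ⟨ψ, hψ, hlt⟩ := happ (ENNReal.ofReal (min k (min δ (ε * δ))))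
      (ENNReal.ofReal_pos.2 (lt_min hk (lt_min hδ (mul_pos hε hδ))))
    simp only [graphNorm, iInf_lt_iff] at hlt
    obtain ⟨k', hk', hle', hlt⟩ := hlt
    rw [ENNReal.ofReal_lt_ofReal_iff_of_nonneg hk'.le, lt_min_iff, lt_min_iff] at hlt
    obtain ⟨hk'k, hk'δ, hk'ε⟩ := hlt
    have hbound : ∀ z, |ψ z| ≤ 2 * C * k := by
      intro z
      rw [mul_comm 2 C, mul_assoc]
      refine hC ψ hψ (2 * k) (by positivity) ?_ z
      calc ∫⁻ ξ in square T, ENNReal.ofReal (|hilferDeriv T χ α β ψ ξ / (2 * k)| ^ γ ξ)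
          ≤ ∫⁻ ξ in square T, (ENNReal.ofReal (|u.2 ξ / k| ^ γ ξ) + ENNReal.ofReal
              (|((ψ, hilferDeriv T χ α β ψ) - u).1 ξ / k'| ^ γ ξ +
                |((ψ, hilferDeriv T χ α β ψ) - u).2 ξ / k'| ^ γ ξ)) := by
            refine setLIntegral_mono' measurableSet_square fun ξ hξ => ?_
            rw [← ENNReal.ofReal_add (by positivity) (by positivity)]
            refine ENNReal.ofReal_le_ofReal ?_
            have hγ0 : 0 ≤ γ ξ := by linarith [hpγ ξ hξ]
            simp only [Prod.fst_sub, Prod.snd_sub, Pi.sub_apply]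
            set d := hilferDeriv T χ α β ψ ξ
            have n1 : 0 ≤ |u.2 ξ / k| ^ γ ξ := by positivity
            have n2 : 0 ≤ |(d - u.2 ξ) / k'| ^ γ ξ := by positivity
            have n3 : 0 ≤ |(ψ ξ - u.1 ξ) / k'| ^ γ ξ := by positivity
            -- An average is at most the maximum; this is where the factor 2 in the constant arises,
            -- and the two modulars add up to at most 2.
            have hmax : |d / (2 * k)| ≤ max |u.2 ξ / k| |(d - u.2 ξ) / k'| := by
              have e1 : d / (2 * k) = (u.2 ξ / k + (d - u.2 ξ) / k) / 2 := by
                field_simp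
                ring
              have e2 : |(d - u.2 ξ) / k| ≤ |(d - u.2 ξ) / k'| := by
                rw [abs_div, abs_div, abs_of_pos hk, abs_of_pos hk']
                gcongr
              have e3 := abs_add_le (u.2 ξ / k) ((d - u.2 ξ) / k)
              rw [e1, abs_div, abs_two]
              have e4 := le_max_left |u.2 ξ / k| |(d - u.2 ξ) / k'|
              have e5 := le_max_right |u.2 ξ / k| |(d - u.2 ξ) / k'|
              linarith
            have h1 := Real.rpow_le_rpow (abs_nonneg _) hmax hγ0
            rcases max_choice |u.2 ξ / k| |(d - u.2 ξ) / k'| with hm | hm <;> rw [hm] at h1 <;>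
              linarith
        _ ≤ 1 + 1 := by
            rw [lintegral_add_left']
            · exact add_le_add hle hle'
            · exact (aemeasurable_abs_rpow hγ (hu₂.1.div₀
                aestronglyMeasurable_const)).ennreal_ofReal
        _ = 2 := one_add_one_eq_two
    have hmeas : AEMeasurable (fun ξ => ENNReal.ofReal (|(ψ ξ - u.1 ξ) / k'| ^ γ ξ))
        (volume.restrict (square T)) :=
      (aemeasurable_abs_rpow hγ ((hψ.1.continuous.aestronglyMeasurable.sub hu₁.1).div₀
        aestronglyMeasurable_const)).ennreal_ofReal
    have hcheb := (mul_meas_ge_le_lintegral₀ hmeas (ENNReal.ofReal (δ / k'))).trans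
      ((lintegral_mono fun ξ => ENNReal.ofReal_le_ofReal (le_add_of_nonneg_right
        (Real.rpow_nonneg (abs_nonneg _) _))).trans hle')
    have hdk : 0 < δ / k' := by positivity
    have hsub : volume.restrict (square T) {ξ | ¬ |u.1 ξ| ≤ 2 * C * k + δ} ≤
        volume.restrict (square T) {ξ | ENNReal.ofReal (δ / k') ≤
          ENNReal.ofReal (|(ψ ξ - u.1 ξ) / k'| ^ γ ξ)} := by
      refine measure_mono_ae ?_
      filter_upwards [ae_restrict_mem measurableSet_square] with ξ hξ hbig
      change ¬ |u.1 ξ| ≤ 2 * C * k + δ at hbig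
      change ENNReal.ofReal (δ / k') ≤ _
      refine ENNReal.ofReal_le_ofReal ?_
      have h1 : δ / k' ≤ |(ψ ξ - u.1 ξ) / k'| := by
        rw [abs_div, abs_of_pos hk']
        gcongr
        have := abs_sub_abs_le_abs_sub (u.1 ξ) (ψ ξ)
        rw [abs_sub_comm] at this
        linarith [hbound ξ, not_le.1 hbig]
      have h2 : 1 ≤ |(ψ ξ - u.1 ξ) / k'| := ((one_le_div hk').2 hk'δ.le).trans h1
      exact h1.trans (Real.self_le_rpow_of_one_le h2 (hp.le.trans (hpγ ξ hξ)))
    refine hsub.trans ?_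
    have h3 := ENNReal.le_div_iff_mul_le (a := volume.restrict (square T)
      {ξ | ENNReal.ofReal (δ / k') ≤ ENNReal.ofReal (|(ψ ξ - u.1 ξ) / k'| ^ γ ξ)})
      (b := ENNReal.ofReal (δ / k')) (c := 1)
      (Or.inl (ENNReal.ofReal_pos.2 hdk).ne') (Or.inl ENNReal.ofReal_ne_top)
    rw [mul_comm] at hcheb
    refine (h3.2 hcheb).trans ?_
    rw [one_div, ← ENNReal.ofReal_inv_of_pos hdk, inv_div, ← ENNReal.ofReal_coe_nnreal]
    refine ENNReal.ofReal_le_ofReal ?_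
    rw [div_le_iff₀ hδ]
    exact hk'ε.le
  have hall := ae_all_iff.2 fun n : ℕ => hstep (1 / (n + 1)) Nat.one_div_pos_of_nat
  filter_upwards [hall] with ξ hξ
  refine le_of_forall_pos_le_add fun δ hδ => ?_
  obtain ⟨n, hn⟩ := exists_nat_one_div_lt hδ
  exact (hξ n).trans (by linarith)

end

/-! ### Derivatives along rays and modular inequalities. -/

section

variable {T : ℝ} {γ ω s η A : ℝ × ℝ → ℝ} {lam : ℝ} {u : (ℝ × ℝ → ℝ) × (ℝ × ℝ → ℝ)}

theorem abs_add_mul_self_rpow {t v e : ℝ} (ht : -1 < t) :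
    |v + t * v| ^ e = (1 + t) ^ e * |v| ^ e := by
  rw [← one_add_mul, abs_mul, abs_of_pos (by linarith),
    Real.mul_rpow (by linarith) (abs_nonneg _)]

theorem integrableOn_mul_abs_add_mul_self_rpow {e w v : ℝ × ℝ → ℝ}
    (he : ContinuousOn e (square T))
    (hi : IntegrableOn (fun ξ => w ξ * |v ξ| ^ e ξ) (square T)) {t : ℝ} (ht : -1 < t) :
    IntegrableOn (fun ξ => w ξ * |v ξ + t * v ξ| ^ e ξ) (square T) := by
  have h1 : ContinuousOn (fun ξ => (1 + t) ^ e ξ) (square T) :=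
    continuousOn_const.rpow he fun ξ _ => Or.inl (by linarith)
  refine (hi.continuousOn_mul h1 isCompact_square).congr_fun (fun ξ _ => ?_) measurableSet_square
  simp only
  rw [abs_add_mul_self_rpow ht]
  ring

/-- Along the ray the integrand is (1+t)^e times a fixed integrable function. For |t| < 1/2 its
derivative is dominated since e - 1 ≥ 0 and 1 + t ≤ 2. -/
theorem hasDerivAt_integral_mul_abs_rpow {e w v : ℝ × ℝ → ℝ} (he : ContinuousOn e (square T))
    (he1 : ∀ ξ ∈ square T, 1 ≤ e ξ)
    (hi : IntegrableOn (fun ξ => w ξ * |v ξ| ^ e ξ) (square T)) :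
    HasDerivAt (fun t : ℝ => ∫ ξ in square T, w ξ * |v ξ + t * v ξ| ^ e ξ)
      (∫ ξ in square T, e ξ * (w ξ * |v ξ| ^ e ξ)) 0 := by
  obtain ⟨E, hE⟩ := isCompact_square.exists_bound_of_continuousOn he
  have key := hasDerivAt_integral_of_dominated_loc_of_deriv_le (μ := volume.restrict (square T))
    (s := Ioo (-1 / 2 : ℝ) (1 / 2)) (x₀ := (0 : ℝ))
    (F := fun t ξ => w ξ * |v ξ + t * v ξ| ^ e ξ)
    (F' := fun t ξ => e ξ * (1 + t) ^ (e ξ - 1) * (w ξ * |v ξ| ^ e ξ))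
    (bound := fun ξ => E * 2 ^ E * |w ξ * |v ξ| ^ e ξ|)
    (Ioo_mem_nhds (by norm_num) (by norm_num)) ?_ ?_ ?_ ?_ ?_ ?_
  · simpa using key.2
  · filter_upwards [Ioo_mem_nhds (show (-1 : ℝ) < 0 by norm_num) one_pos] with t ht
    exact (integrableOn_mul_abs_add_mul_self_rpow he hi ht.1).aestronglyMeasurable
  · simpa [IntegrableOn] using hi
  · simpa using (hi.continuousOn_mul he isCompact_square).aestronglyMeasurable
  · filter_upwards [ae_restrict_mem measurableSet_square] with ξ hξ t ht
    have h1 := he1 ξ hξ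
    have h2 : e ξ ≤ E := (le_abs_self _).trans (hE ξ hξ)
    have h3 : (1 + t) ^ (e ξ - 1) ≤ 2 ^ E :=
      (Real.rpow_le_rpow (by linarith [ht.1]) (by linarith [ht.2]) (by linarith)).trans
        (Real.rpow_le_rpow_of_exponent_le one_le_two (by linarith))
    have h4 : 0 ≤ (1 + t) ^ (e ξ - 1) := Real.rpow_nonneg (by linarith [ht.1]) _
    rw [Real.norm_eq_abs, abs_mul, abs_of_nonneg (by positivity : 0 ≤ e ξ * (1 + t) ^ (e ξ - 1))]
    gcongr
    linarith
  · exact hi.abs.const_mul _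
  · refine .of_forall fun ξ t ht => ?_
    have ht1 : -1 < t := by linarith [ht.1]
    have h1 : HasDerivAt (fun t : ℝ => 1 + t) 1 t := (hasDerivAt_id t).const_add 1
    have h2 := (h1.rpow_const (p := e ξ) (Or.inl (by linarith))).mul_const (w ξ * |v ξ| ^ e ξ)
    rw [one_mul] at h2
    refine h2.congr_of_eventuallyEq ?_
    filter_upwards [lt_mem_nhds ht1] with r hr
    rw [abs_add_mul_self_rpow hr]
    ring

/-- The three integrals of the Euler functional converge at `u`. -/
structure FiniteEnergy (T : ℝ) (γ ω s η A : ℝ × ℝ → ℝ)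
    (u : (ℝ × ℝ → ℝ) × (ℝ × ℝ → ℝ)) : Prop where
  integrable_deriv : IntegrableOn (fun ξ => |u.2 ξ| ^ γ ξ) (square T)
  integrable_sub : IntegrableOn (fun ξ => η ξ * |u.1 ξ| ^ ω ξ) (square T)
  integrable_super : IntegrableOn (fun ξ => A ξ * |u.1 ξ| ^ s ξ) (square T)

/-- Continuous exponents on the square, larger than one. -/
def IsExponent (T : ℝ) (e : ℝ × ℝ → ℝ) : Prop :=
  ContinuousOn e (square T) ∧ ∀ ξ ∈ square T, 1 < e ξ

theorem IsExponent.continuousOn_one_div {e : ℝ × ℝ → ℝ} (he : IsExponent T e) :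
    ContinuousOn (fun ξ => 1 / e ξ) (square T) :=
  continuousOn_const.div he.1 fun ξ hξ => by linarith [he.2 ξ hξ]

namespace FiniteEnergy

/-- Differentiating `nehariFun` along the ray needs its formula at all nearby points of the ray. -/
theorem add_smul_self (hu : FiniteEnergy T γ ω s η A u) (hγ : IsExponent T γ)
    (hω : IsExponent T ω) (hs : IsExponent T s) {t : ℝ} (ht : -1 < t) :
    FiniteEnergy T γ ω s η A (u + t • u) where
  integrable_deriv := by
    have h1 : IntegrableOn (fun ξ => 1 * |u.2 ξ| ^ γ ξ) (square T) := by
      simpa using hu.integrable_deriv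
    have h2 := integrableOn_mul_abs_add_mul_self_rpow hγ.1 h1 ht
    simp only [one_mul] at h2
    exact h2
  integrable_sub := integrableOn_mul_abs_add_mul_self_rpow hω.1 hu.integrable_sub ht
  integrable_super := integrableOn_mul_abs_add_mul_self_rpow hs.1 hu.integrable_super ht

theorem nehariFun_eq (hu : FiniteEnergy T γ ω s η A u) (hγ : IsExponent T γ)
    (hω : IsExponent T ω) (hs : IsExponent T s) :
    nehariFun T γ ω s η A lam u = (∫ ξ in square T, |u.2 ξ| ^ γ ξ) -
      lam * (∫ ξ in square T, η ξ * |u.1 ξ| ^ ω ξ) - ∫ ξ in square T, A ξ * |u.1 ξ| ^ s ξ := by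
  have h1 := hasDerivAt_integral_mul_abs_rpow hγ.1 (fun ξ hξ => (hγ.2 ξ hξ).le)
    (hu.integrable_deriv.continuousOn_mul hγ.continuousOn_one_div isCompact_square)
  have h2 := hasDerivAt_integral_mul_abs_rpow (w := fun ξ => 1 / ω ξ * η ξ) hω.1
    (fun ξ hξ => (hω.2 ξ hξ).le) (by
      simpa only [mul_assoc] using
        hu.integrable_sub.continuousOn_mul hω.continuousOn_one_div isCompact_square)
  have h3 := hasDerivAt_integral_mul_abs_rpow (w := fun ξ => 1 / s ξ * A ξ) hs.1
    (fun ξ hξ => (hs.2 ξ hξ).le) (by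
      simpa only [mul_assoc] using
        hu.integrable_super.continuousOn_mul hs.continuousOn_one_div isCompact_square)
  have h4 := ((h1.sub (h2.const_mul lam)).sub h3).deriv
  refine h4.trans ?_
  congr 1
  · congr 1
    · refine setIntegral_congr_fun measurableSet_square fun ξ hξ => ?_
      have := hγ.2 ξ hξ
      field_simp
    · congr 1
      refine setIntegral_congr_fun measurableSet_square fun ξ hξ => ?_
      have := hω.2 ξ hξ
      field_simp
  · refine setIntegral_congr_fun measurableSet_square fun ξ hξ => ?_
    have := hs.2 ξ hξ
    field_simp

theorem nehariFunDeriv_eq (hu : FiniteEnergy T γ ω s η A u) (hγ : IsExponent T γ)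
    (hω : IsExponent T ω) (hs : IsExponent T s) :
    nehariFunDeriv T γ ω s η A lam u = (∫ ξ in square T, γ ξ * |u.2 ξ| ^ γ ξ) -
      lam * (∫ ξ in square T, ω ξ * (η ξ * |u.1 ξ| ^ ω ξ)) -
      ∫ ξ in square T, s ξ * (A ξ * |u.1 ξ| ^ s ξ) := by
  have h1 := hasDerivAt_integral_mul_abs_rpow (w := fun _ => 1) (v := u.2) hγ.1
    (fun ξ hξ => (hγ.2 ξ hξ).le) (by simpa using hu.integrable_deriv)
  simp only [one_mul] at h1
  have h2 := hasDerivAt_integral_mul_abs_rpow hω.1 (fun ξ hξ => (hω.2 ξ hξ).le) hu.integrable_sub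
  have h3 := hasDerivAt_integral_mul_abs_rpow hs.1 (fun ξ hξ => (hs.2 ξ hξ).le)
    hu.integrable_super
  refine (((h1.sub (h2.const_mul lam)).sub h3).congr_of_eventuallyEq ?_).deriv
  filter_upwards [lt_mem_nhds (show (-1 : ℝ) < 0 by norm_num)] with t ht
  exact (hu.add_smul_self hγ hω hs ht).nehariFun_eq hγ hω hs

end FiniteEnergy

theorem integral_mul_le_of_le {e G : ℝ × ℝ → ℝ} (he : ContinuousOn e (square T))
    (hG : IntegrableOn G (square T)) (hG0 : ∀ ξ ∈ square T, 0 ≤ G ξ) {c : ℝ}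
    (hc : ∀ ξ ∈ square T, e ξ ≤ c) : ∫ ξ in square T, e ξ * G ξ ≤ c * ∫ ξ in square T, G ξ := by
  rw [← integral_const_mul]
  exact setIntegral_mono_on (hG.continuousOn_mul he isCompact_square) (hG.const_mul c)
    measurableSet_square fun ξ hξ => mul_le_mul_of_nonneg_right (hc ξ hξ) (hG0 ξ hξ)

theorem le_integral_mul_of_le {e G : ℝ × ℝ → ℝ} (he : ContinuousOn e (square T))
    (hG : IntegrableOn G (square T)) (hG0 : ∀ ξ ∈ square T, 0 ≤ G ξ) {c : ℝ}
    (hc : ∀ ξ ∈ square T, c ≤ e ξ) : c * ∫ ξ in square T, G ξ ≤ ∫ ξ in square T, e ξ * G ξ := by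
  rw [← integral_const_mul]
  exact setIntegral_mono_on (hG.const_mul c) (hG.continuousOn_mul he isCompact_square)
    measurableSet_square fun ξ hξ => mul_le_mul_of_nonneg_right (hc ξ hξ) (hG0 ξ hξ)

/-- The bound C k is split because C ≥ 1 always favours the largest exponent, whereas the extremal
power of k depends on whether k ≤ 1; m keeps that choice open. -/
theorem integral_mul_abs_rpow_le {f e v : ℝ × ℝ → ℝ} (hf : ContinuousOn f (square T))
    (he : ContinuousOn e (square T)) {F E C k m : ℝ} (hF0 : 0 ≤ F)
    (hF : ∀ ξ ∈ square T, |f ξ| ≤ F) (he0 : ∀ ξ ∈ square T, 0 ≤ e ξ)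
    (hE : ∀ ξ ∈ square T, e ξ ≤ E) (hC : 1 ≤ C) (hk : 0 ≤ k)
    (hm : ∀ ξ ∈ square T, k ^ e ξ ≤ m)
    (hv : AEStronglyMeasurable v (volume.restrict (square T)))
    (hb : ∀ᵐ ξ ∂volume.restrict (square T), |v ξ| ≤ C * k) :
    IntegrableOn (fun ξ => f ξ * |v ξ| ^ e ξ) (square T) ∧
      ∫ ξ in square T, f ξ * |v ξ| ^ e ξ ≤ F * (C ^ E * m) * volume.real (square T) := by
  have hbd : ∀ᵐ ξ ∂volume.restrict (square T), ‖f ξ * |v ξ| ^ e ξ‖ ≤ F * (C ^ E * m) := by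
    filter_upwards [hb, ae_restrict_mem measurableSet_square] with ξ h1 hξ
    have h2 : |v ξ| ^ e ξ ≤ C ^ E * m := by
      refine (Real.rpow_le_rpow (abs_nonneg _) h1 (he0 ξ hξ)).trans ?_
      rw [Real.mul_rpow (by linarith) hk]
      exact mul_le_mul (Real.rpow_le_rpow_of_exponent_le hC (hE ξ hξ)) (hm ξ hξ)
        (Real.rpow_nonneg hk _) (by positivity)
    rw [Real.norm_eq_abs, abs_mul, abs_of_nonneg (Real.rpow_nonneg (abs_nonneg _) _)]
    exact mul_le_mul (hF ξ hξ) h2 (Real.rpow_nonneg (abs_nonneg _) _) hF0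
  refine ⟨⟨(hf.aestronglyMeasurable measurableSet_square).mul
    (aemeasurable_abs_rpow he hv).aestronglyMeasurable,
    .restrict_of_bounded _ volume_square_lt_top hbd⟩, ?_⟩
  exact (le_abs_self _).trans (norm_setIntegral_le_of_norm_le_const_ae volume_square_lt_top hbd)

theorem MemVarLp.integrableOn {v : ℝ × ℝ → ℝ} (hv : MemVarLp T γ v)
    (hγ : ContinuousOn γ (square T)) : IntegrableOn (fun ξ => |v ξ| ^ γ ξ) (square T) := by
  refine ⟨(aemeasurable_abs_rpow hγ hv.1).aestronglyMeasurable, ?_⟩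
  rw [hasFiniteIntegral_iff_ofReal (.of_forall fun ξ => by positivity)]
  exact hv.2

theorem infOn_le (hf : ContinuousOn γ (square T)) {ξ : ℝ × ℝ} (hξ : ξ ∈ square T) :
    infOn T γ ≤ γ ξ :=
  csInf_le (isCompact_square.bddBelow_image hf) (mem_image_of_mem _ hξ)

theorem le_supOn (hf : ContinuousOn γ (square T)) {ξ : ℝ × ℝ} (hξ : ξ ∈ square T) :
    γ ξ ≤ supOn T γ :=
  le_csSup (isCompact_square.bddAbove_image hf) (mem_image_of_mem _ hξ)

/-- Pointwise k^γ is at least the smaller of k^lo and k^hi, whichever side of 1 the scale k lies on.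
-/
theorem lintegral_abs_div_rpow_le_one {v : ℝ × ℝ → ℝ} {lo hi k : ℝ}
    (hlo : ∀ ξ ∈ square T, lo ≤ γ ξ) (hhi : ∀ ξ ∈ square T, γ ξ ≤ hi)
    (hv : IntegrableOn (fun ξ => |v ξ| ^ γ ξ) (square T)) (hk : 0 < k)
    (h1 : ∫ ξ in square T, |v ξ| ^ γ ξ ≤ k ^ lo) (h2 : ∫ ξ in square T, |v ξ| ^ γ ξ ≤ k ^ hi) :
    ∫⁻ ξ in square T, ENNReal.ofReal (|v ξ / k| ^ γ ξ) ≤ 1 := by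
  have hm : 0 < min (k ^ lo) (k ^ hi) := lt_min (by positivity) (by positivity)
  calc ∫⁻ ξ in square T, ENNReal.ofReal (|v ξ / k| ^ γ ξ)
      ≤ ∫⁻ ξ in square T, ENNReal.ofReal (|v ξ| ^ γ ξ / min (k ^ lo) (k ^ hi)) := by
        refine setLIntegral_mono' measurableSet_square fun ξ hξ => ENNReal.ofReal_le_ofReal ?_
        rw [abs_div, abs_of_pos hk, Real.div_rpow (abs_nonneg _) hk.le]
        refine div_le_div_of_nonneg_left (by positivity) hm ?_
        rcases le_total 1 k with h | h
        · exact (min_le_left _ _).trans (Real.rpow_le_rpow_of_exponent_le h (hlo ξ hξ))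
        · exact (min_le_right _ _).trans (Real.rpow_le_rpow_of_exponent_ge hk h (hhi ξ hξ))
    _ = ENNReal.ofReal ((∫ ξ in square T, |v ξ| ^ γ ξ) / min (k ^ lo) (k ^ hi)) := by
        rw [← integral_div, ofReal_integral_eq_lintegral_ofReal (hv.div_const _)
          (.of_forall fun ξ => by positivity)]
    _ ≤ 1 := by
        rw [← ENNReal.ofReal_one]
        exact ENNReal.ofReal_le_ofReal ((div_le_one hm).2 (le_min h1 h2))

/-- A superlinear quantity cannot dominate a linear one near 0. This is the source of the
λ-independent lower bound on D. -/
theorem rpow_inv_le_of_mul_le_mul_rpow {c K r D : ℝ} (hc : 0 < c) (hK : 0 < K) (hr : 1 < r)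
    (hD : 0 < D) (h : c * D ≤ K * D ^ r) : (c / K) ^ (1 / (r - 1)) ≤ D := by
  have h1 : c / K ≤ D ^ (r - 1) := by
    rw [Real.rpow_sub_one hD.ne', div_le_div_iff₀ hK hD]
    linarith
  have h2 : 0 < r - 1 := sub_pos.2 hr
  calc (c / K) ^ (1 / (r - 1)) ≤ (D ^ (r - 1)) ^ (1 / (r - 1)) :=
        Real.rpow_le_rpow (by positivity) h1 (by positivity)
    _ = D := by rw [← Real.rpow_mul hD.le, mul_one_div_cancel h2.ne', Real.rpow_one]

end

/-! ### Bounds for the three integrals on the space. -/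

section

variable {T : ℝ} {χ : ℝ → ℝ} {γ ω s η A : ℝ × ℝ → ℝ}

/-- Estimates of the three integrals of the Euler functional on the fractional derivative space. -/
theorem exists_estimates_of_mem_hilferSpace (h : Admissible T χ) (hγ : ContinuousOn γ (square T))
    (hω : ContinuousOn ω (square T)) (hs : ContinuousOn s (square T))
    (hη : ContinuousOn η (square T)) (hA : ContinuousOn A (square T))
    {g₁ g₂ w₂ s₁ s₂ : ℝ} (hg₁ : 1 < g₁) (hγ₁ : ∀ ξ ∈ square T, g₁ ≤ γ ξ)
    (hγ₂ : ∀ ξ ∈ square T, γ ξ ≤ g₂) (hω₀ : ∀ ξ ∈ square T, 0 ≤ ω ξ)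
    (hω₂ : ∀ ξ ∈ square T, ω ξ ≤ w₂) (hwg : w₂ ≤ g₁) (hs₀ : 0 ≤ s₁)
    (hs₁ : ∀ ξ ∈ square T, s₁ ≤ s ξ) (hs₂ : ∀ ξ ∈ square T, s ξ ≤ s₂)
    {α : ℝ × ℝ} (hα₁ : 1 / g₁ < α.1) (hα₁' : α.1 < 1) (hα₂ : 1 / g₁ < α.2) (hα₂' : α.2 < 1)
    {β : ℝ} (hβ0 : 0 ≤ β) (hβ1 : β ≤ 1) :
    ∃ K B : ℝ, 0 < K ∧ 0 < B ∧ ∀ u ∈ hilferSpace T χ α β γ,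
      ¬ (u.1 =ᵐ[volume.restrict (square T)] 0) →
      FiniteEnergy T γ ω s η A u ∧ 0 < ∫ ξ in square T, |u.2 ξ| ^ γ ξ ∧
      (∫ ξ in square T, |u.2 ξ| ^ γ ξ ≤ 1 → ∫ ξ in square T, A ξ * |u.1 ξ| ^ s ξ ≤
        K * (∫ ξ in square T, |u.2 ξ| ^ γ ξ) ^ (s₁ / g₂)) ∧
      ∀ d : ℝ, 0 < d → d ≤ 1 → d ≤ ∫ ξ in square T, |u.2 ξ| ^ γ ξ →
        ∫ ξ in square T, η ξ * |u.1 ξ| ^ ω ξ ≤ B * ((∫ ξ in square T, |u.2 ξ| ^ γ ξ) / d) := by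
  obtain ⟨C₀, -, hC₀⟩ := exists_ae_bound_of_mem_hilferSpace h hγ hg₁ hγ₁ hα₁ hα₁' hα₂ hα₂' hβ0 hβ1
  obtain ⟨M₁, hM₁⟩ := isCompact_square.exists_bound_of_continuousOn hη
  obtain ⟨M₂, hM₂⟩ := isCompact_square.exists_bound_of_continuousOn hA
  have h00 : ((0, 0) : ℝ × ℝ) ∈ square T := ⟨⟨le_rfl, h.pos.le⟩, ⟨le_rfl, h.pos.le⟩⟩
  have hM₁0 : 0 ≤ M₁ := (norm_nonneg _).trans (hM₁ _ h00)
  have hM₂0 : 0 ≤ M₂ := (norm_nonneg _).trans (hM₂ _ h00)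
  have hw₂ : 0 ≤ w₂ := (hω₀ _ h00).trans (hω₂ _ h00)
  have hg₂ : 0 < g₂ := by linarith [hγ₁ _ h00, hγ₂ _ h00]
  have hg₁0 : 0 < g₁ := by linarith
  set C := max C₀ 1 with hC
  have hC1 : 1 ≤ C := le_max_right _ _
  set V := volume.real (square T) with hV
  have hV0 : 0 ≤ V := measureReal_nonneg
  refine ⟨M₂ * C ^ s₂ * V + 1, M₁ * C ^ w₂ * V + 1, by positivity, by positivity,
    fun u hu hne => ?_⟩
  have hi := hu.2.1.integrableOn hγ
  have hv := hu.1.1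
  set D := ∫ ξ in square T, |u.2 ξ| ^ γ ξ with hD
  have hD0 : 0 ≤ D := integral_nonneg fun ξ => by positivity
  have hbound : ∀ k : ℝ, 0 < k → D ≤ k ^ g₁ → D ≤ k ^ g₂ →
      ∀ᵐ ξ ∂volume.restrict (square T), |u.1 ξ| ≤ C * k := by
    intro k hk h1 h2
    filter_upwards [hC₀ u hu k hk (lintegral_abs_div_rpow_le_one hγ₁ hγ₂ hi hk h1 h2)] with ξ hξ
    exact hξ.trans (mul_le_mul_of_nonneg_right (le_max_left _ _) hk.le)
  -- If D = 0, every scale k = 1/(n+1) is admissible, and the L^∞ bound forces u.1 = 0 almost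
  -- everywhere.
  have hDpos : 0 < D := by
    refine hD0.lt_of_ne fun hD0 => hne ?_
    have h1 := ae_all_iff.2 fun n : ℕ => hbound (1 / (n + 1)) Nat.one_div_pos_of_nat
      (by rw [← hD0]; positivity) (by rw [← hD0]; positivity)
    filter_upwards [h1] with ξ hξ
    refine abs_eq_zero.1 (le_antisymm (le_of_forall_pos_le_add fun δ hδ => ?_) (abs_nonneg _))
    obtain ⟨n, hn⟩ := exists_nat_one_div_lt (show 0 < δ / C by positivity)
    rw [lt_div_iff₀ (by positivity)] at hn
    linarith [hξ n]
  -- The least scale with D ≤ k^g₁ and D ≤ k^g₂; the second term is the maximum when D ≤ 1, the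
  -- first when D ≥ 1.
  set k := max (D ^ (1 / g₁)) (D ^ (1 / g₂)) with hk
  have hpow : ∀ g : ℝ, 0 < g → (D ^ (1 / g)) ^ g = D := fun g hg => by
    rw [← Real.rpow_mul hD0, one_div_mul_cancel hg.ne', Real.rpow_one]
  have hk0 : 0 < k := (Real.rpow_pos_of_pos hDpos _).trans_le (le_max_left _ _)
  have hkb := hbound k hk0
    ((hpow g₁ hg₁0).symm.le.trans (Real.rpow_le_rpow (by positivity) (le_max_left _ _) hg₁0.le))
    ((hpow g₂ hg₂).symm.le.trans (Real.rpow_le_rpow (by positivity) (le_max_right _ _) hg₂.le))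
  have hinv : 1 / g₂ ≤ 1 / g₁ :=
    one_div_le_one_div_of_le hg₁0 ((hγ₁ _ h00).trans (hγ₂ _ h00))
  have hk_small : D ≤ 1 → k = D ^ (1 / g₂) := fun hD1 =>
    max_eq_right (Real.rpow_le_rpow_of_exponent_ge hDpos hD1 hinv)
  have hk_large : 1 ≤ D → k = D ^ (1 / g₁) := fun hD1 =>
    max_eq_left (Real.rpow_le_rpow_of_exponent_le hD1 hinv)
  have hk_le : ∀ e : ℝ × ℝ → ℝ, ∀ E : ℝ, (∀ ξ ∈ square T, 0 ≤ e ξ) → (∀ ξ ∈ square T, e ξ ≤ E) →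
      ∀ ξ ∈ square T, k ^ e ξ ≤ max 1 k ^ E := fun e E he hE ξ hξ =>
    (Real.rpow_le_rpow hk0.le (le_max_right _ _) (he ξ hξ)).trans
      (Real.rpow_le_rpow_of_exponent_le (le_max_left _ _) (hE ξ hξ))
  have hsnn : ∀ ξ ∈ square T, 0 ≤ s ξ := fun ξ hξ => hs₀.trans (hs₁ ξ hξ)
  refine ⟨⟨hi, ?_, ?_⟩, hDpos, fun hD1 => ?_, fun d hd hd1 hdD => ?_⟩
  · exact (integral_mul_abs_rpow_le hη hω hM₁0 hM₁ hω₀ hω₂ hC1 hk0.le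
      (hk_le ω w₂ hω₀ hω₂) hv hkb).1
  · exact (integral_mul_abs_rpow_le hA hs hM₂0 hM₂ hsnn hs₂ hC1 hk0.le
      (hk_le s s₂ hsnn hs₂) hv hkb).1
  · have hk1 : k ≤ 1 := by
      rw [hk_small hD1]
      exact Real.rpow_le_one hD0 hD1 (by positivity)
    refine (integral_mul_abs_rpow_le (m := D ^ (s₁ / g₂)) hA hs hM₂0 hM₂ hsnn hs₂ hC1 hk0.le
      (fun ξ hξ => ?_) hv hkb).2.trans ?_
    · refine (Real.rpow_le_rpow_of_exponent_ge hk0 hk1 (hs₁ ξ hξ)).trans ?_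
      rw [hk_small hD1, ← Real.rpow_mul hD0, one_div_mul_eq_div]
    · have := Real.rpow_nonneg hD0 (s₁ / g₂)
      linarith
  · refine (integral_mul_abs_rpow_le (m := D / d) hη hω hM₁0 hM₁ hω₀ hω₂ hC1 hk0.le
      (fun ξ hξ => ?_) hv hkb).2.trans ?_
    · refine (hk_le ω w₂ hω₀ hω₂ ξ hξ).trans ?_
      have hDd : D ≤ D / d := (le_div_iff₀ hd).2 (mul_le_of_le_one_right hD0 hd1)
      -- For D ≤ 1 the power of k is at most 1 ≤ D/d; for D ≥ 1 it is at most D^(w₂/g₁) ≤ D, since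
      -- w₂ ≤ g₁.
      rcases le_total D 1 with hD1 | hD1
      · have hk1 : k ≤ 1 := by
          rw [hk_small hD1]
          exact Real.rpow_le_one hD0 hD1 (by positivity)
        rw [max_eq_left hk1, Real.one_rpow]
        exact (one_le_div hd).2 hdD
      · have hk1 : 1 ≤ k := by
          rw [hk_large hD1]
          exact Real.one_le_rpow hD1 (by positivity)
        rw [max_eq_right hk1, hk_large hD1, ← Real.rpow_mul hD0]
        refine le_trans ?_ hDd
        refine (Real.rpow_le_rpow_of_exponent_le hD1 ?_).trans (Real.rpow_one D).le
        rw [one_div_mul_eq_div]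
        exact (div_le_one hg₁0).2 hwg
    · have : 0 ≤ D / d := by positivity
      linarith

end

end HilferNehari

/-! ### The Nehari argument. -/

open HilferNehari in
theorem mainTheorem7
    (T : ℝ) (hT : 0 < T)
    (χ : ℝ → ℝ) (hχ : ContDiffOn ℝ 1 χ (Set.Icc 0 T))
    (hχ' : ∀ x ∈ Set.Icc 0 T, 0 < derivWithin χ (Set.Icc 0 T) x)
    (γ ω s η A : ℝ × ℝ → ℝ)
    (hγ : ContinuousOn γ (HilferNehari.square T))
    (hω : ContinuousOn ω (HilferNehari.square T))
    (hs : ContinuousOn s (HilferNehari.square T))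
    (hη : ContinuousOn η (HilferNehari.square T))
    (hA : ContinuousOn A (HilferNehari.square T))
    (hη0 : ∀ ξ ∈ HilferNehari.square T, 0 ≤ η ξ)
    (hA0 : ∀ ξ ∈ HilferNehari.square T, 0 ≤ A ξ)
    (h1ω : 1 < HilferNehari.infOn T ω)
    (hωγ : HilferNehari.supOn T ω < HilferNehari.infOn T γ)
    (hγs : HilferNehari.supOn T γ < HilferNehari.infOn T s)
    (α : ℝ × ℝ)
    (hα₁ : ∀ ξ ∈ HilferNehari.square T, 1 / γ ξ < α.1) (hα₁' : α.1 < 1)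
    (hα₂ : ∀ ξ ∈ HilferNehari.square T, 1 / γ ξ < α.2) (hα₂' : α.2 < 1)
    (β : ℝ) (hβ0 : 0 ≤ β) (hβ1 : β ≤ 1) :
    ∃ lam₁ : ℝ, 0 < lam₁ ∧ ∀ lam : ℝ, 0 < lam → lam < lam₁ →
      HilferNehari.nehariZero T χ α β γ ω s η A lam = ∅ ∧
      ∀ u ∈ HilferNehari.nehariNeg T χ α β γ ω s η A lam,
        0 < HilferNehari.energy T γ ω s η A lam u := by
  have h : Admissible T χ := ⟨hT, hχ, hχ'⟩
  have h00 : ((0, 0) : ℝ × ℝ) ∈ square T := ⟨⟨le_rfl, hT.le⟩, ⟨le_rfl, hT.le⟩⟩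
  -- The minimum is attained, so the pointwise condition on α yields the strict inequality 1/γ⁻ <
  -- α_j.
  obtain ⟨ξ₀, hξ₀, hinf⟩ := isCompact_square.exists_sInf_image_eq ⟨_, h00⟩ hγ
  change infOn T γ = γ ξ₀ at hinf
  have bγ₁ := fun ξ hξ => infOn_le hγ (ξ := ξ) hξ
  have bγ₂ := fun ξ hξ => le_supOn hγ (ξ := ξ) hξ
  have bω₁ := fun ξ hξ => infOn_le hω (ξ := ξ) hξ
  have bω₂ := fun ξ hξ => le_supOn hω (ξ := ξ) hξ
  have bs₁ := fun ξ hξ => infOn_le hs (ξ := ξ) hξ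
  have bs₂ := fun ξ hξ => le_supOn hs (ξ := ξ) hξ
  have hα₁ := hinf ▸ hα₁ ξ₀ hξ₀
  have hα₂ := hinf ▸ hα₂ ξ₀ hξ₀
  have hγ₁₂ := (bγ₁ _ h00).trans (bγ₂ _ h00)
  have hω₁₂ := (bω₁ _ h00).trans (bω₂ _ h00)
  have hs₁₂ := (bs₁ _ h00).trans (bs₂ _ h00)
  clear hinf
  generalize infOn T γ = g₁ at *
  generalize supOn T γ = g₂ at *
  generalize infOn T ω = w₁ at *
  generalize supOn T ω = w₂ at *
  generalize infOn T s = s₁ at *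
  generalize supOn T s = s₂ at *
  have eγ : IsExponent T γ := ⟨hγ, fun ξ hξ => by linarith [bγ₁ ξ hξ]⟩
  have eω : IsExponent T ω := ⟨hω, fun ξ hξ => by linarith [bω₁ ξ hξ]⟩
  have es : IsExponent T s := ⟨hs, fun ξ hξ => by linarith [bs₁ ξ hξ]⟩
  obtain ⟨K, B, hK, hB, hest⟩ := exists_estimates_of_mem_hilferSpace h hγ hω hs hη hA
    (by linarith) bγ₁ bγ₂ (fun ξ hξ => by linarith [bω₁ ξ hξ]) bω₂ hωγ.le (by linarith) bs₁ bs₂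
    hα₁ hα₁' hα₂ hα₂' hβ0 hβ1
  have hg₁0 : 0 < g₁ := by linarith
  have hg₂0 : 0 < g₂ := by linarith
  have hw₁0 : 0 < w₁ := by linarith
  have hs₁0 : 0 < s₁ := by linarith
  have hr : 1 < s₁ / g₂ := (one_lt_div hg₂0).2 hγs
  set c := (g₁ - w₂) / (s₂ - w₂) with hc
  have hc0 : 0 < c := div_pos (by linarith) (by linarith)
  -- From c D ≤ S ≤ K D^(s₁/g₂) when D ≤ 1; the minimum with 1 covers D ≥ 1.
  set d := min 1 ((c / K) ^ (1 / (s₁ / g₂ - 1))) with hd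
  have hd0 : 0 < d := lt_min one_pos (by positivity)
  have hgap : 0 < 1 / g₂ - 1 / s₁ := sub_pos.2 (one_div_lt_one_div_of_lt hg₂0 hγs)
  have hBd : 0 < B / d := by positivity
  -- Only the sign ≤ 0 of the second derivative is used, so this serves both the degenerate and the
  -- negative part.
  have main : ∀ lam : ℝ, 0 < lam → ∀ u ∈ nehari T χ α β γ ω s η A lam,
      nehariFunDeriv T γ ω s η A lam u ≤ 0 → ∃ D W S : ℝ, 0 < D ∧ 0 ≤ W ∧ D = lam * W + S ∧
        W ≤ B / d * D ∧ g₂ * D - lam * (w₁ * W) - s₁ * S ≥ nehariFunDeriv T γ ω s η A lam u ∧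
        1 / g₂ * D - lam * (1 / w₁ * W) - 1 / s₁ * S ≤ energy T γ ω s η A lam u := by
    rintro lam hlam u ⟨hu, hne, hzero⟩ hder
    obtain ⟨hfin, hD, hS, hW⟩ := hest u hu hne
    have nD : ∀ ξ ∈ square T, 0 ≤ |u.2 ξ| ^ γ ξ := fun ξ _ => by positivity
    have nW : ∀ ξ ∈ square T, 0 ≤ η ξ * |u.1 ξ| ^ ω ξ := fun ξ hξ =>
      mul_nonneg (hη0 ξ hξ) (by positivity)
    have nS : ∀ ξ ∈ square T, 0 ≤ A ξ * |u.1 ξ| ^ s ξ := fun ξ hξ =>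
      mul_nonneg (hA0 ξ hξ) (by positivity)
    have iD := hfin.integrable_deriv
    have iW := hfin.integrable_sub
    have iS := hfin.integrable_super
    rw [hfin.nehariFun_eq eγ eω es] at hzero
    rw [hfin.nehariFunDeriv_eq eγ eω es] at hder ⊢
    have hW0 := setIntegral_nonneg (μ := volume) measurableSet_square nW
    have a1 := le_integral_mul_of_le hγ iD nD bγ₁
    have a2 := integral_mul_le_of_le hγ iD nD bγ₂
    have a3 := le_integral_mul_of_le hω iW nW bω₁
    have a4 := integral_mul_le_of_le hω iW nW bω₂
    have a5 := le_integral_mul_of_le hs iS nS bs₁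
    have a6 := integral_mul_le_of_le hs iS nS bs₂
    have c1 := le_integral_mul_of_le eγ.continuousOn_one_div iD nD (c := 1 / g₂) fun ξ hξ =>
      one_div_le_one_div_of_le (by linarith [bγ₁ ξ hξ]) (bγ₂ ξ hξ)
    have c2 := integral_mul_le_of_le eω.continuousOn_one_div iW nW (c := 1 / w₁) fun ξ hξ =>
      one_div_le_one_div_of_le hw₁0 (bω₁ ξ hξ)
    have c3 := integral_mul_le_of_le es.continuousOn_one_div iS nS (c := 1 / s₁) fun ξ hξ =>
      one_div_le_one_div_of_le hs₁0 (bs₁ ξ hξ)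
    simp only [energy, mul_assoc]
    generalize ∫ ξ in square T, γ ξ * |u.2 ξ| ^ γ ξ = D' at *
    generalize ∫ ξ in square T, ω ξ * (η ξ * |u.1 ξ| ^ ω ξ) = W' at *
    generalize ∫ ξ in square T, s ξ * (A ξ * |u.1 ξ| ^ s ξ) = S' at *
    generalize ∫ ξ in square T, 1 / γ ξ * |u.2 ξ| ^ γ ξ = D'' at *
    generalize ∫ ξ in square T, 1 / ω ξ * (η ξ * |u.1 ξ| ^ ω ξ) = W'' at *
    generalize ∫ ξ in square T, 1 / s ξ * (A ξ * |u.1 ξ| ^ s ξ) = S'' at *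
    generalize ∫ ξ in square T, |u.2 ξ| ^ γ ξ = D at *
    generalize ∫ ξ in square T, η ξ * |u.1 ξ| ^ ω ξ = W at *
    generalize ∫ ξ in square T, A ξ * |u.1 ξ| ^ s ξ = S at *
    have b3 := mul_le_mul_of_nonneg_left a3 hlam.le
    have b4 := mul_le_mul_of_nonneg_left a4 hlam.le
    have b2 := mul_le_mul_of_nonneg_left c2 hlam.le
    have hDeq : lam * W = D - S := by linarith
    -- Bound γ below and ω, s above in the second derivative, then replace λW by D - S.
    have hcD : c * D ≤ S := by
      rw [hc, div_mul_eq_mul_div, div_le_iff₀ (by linarith)]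
      have : lam * (w₂ * W) = w₂ * (D - S) := by rw [← hDeq]; ring
      linarith
    have hdD : d ≤ D := by
      rcases le_total D 1 with hD1 | hD1
      · exact (min_le_right _ _).trans
          (rpow_inv_le_of_mul_le_mul_rpow hc0 hK hr hD (hcD.trans (hS hD1)))
      · exact (min_le_left _ _).trans hD1
    refine ⟨D, W, S, hD, hW0, by linarith, ?_, by linarith, by linarith⟩
    rw [div_mul_eq_mul_div, mul_div_assoc]
    exact hW d hd0 (min_le_left _ _) hdD
  -- With λW ≤ λ(B/d)D, the first threshold excludes the degenerate part and the second makes the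
  -- energy positive.
  refine ⟨min ((s₁ - g₂) / (B / d * (s₁ - w₁))) ((1 / g₂ - 1 / s₁) * w₁ / (B / d)),
    lt_min (div_pos (by linarith) (mul_pos hBd (by linarith))) (by positivity),
    fun lam hlam hlt => ?_⟩
  rw [lt_min_iff, lt_div_iff₀ (mul_pos hBd (by linarith)), lt_div_iff₀ hBd] at hlt
  obtain ⟨hlt₁, hlt₂⟩ := hlt
  constructor
  · refine Set.eq_empty_iff_forall_notMem.2 fun u ⟨hu, hder⟩ => ?_
    obtain ⟨D, W, S, hD, hW, hDeq, hWD, hder', -⟩ := main lam hlam u hu hder.le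
    rw [hder] at hder'
    have h1 : lam * W ≤ lam * (B / d * D) := mul_le_mul_of_nonneg_left hWD hlam.le
    have h2 : (s₁ - g₂) * D ≤ (s₁ - w₁) * (lam * W) := by
      have hS' : S = D - lam * W := by linarith
      rw [hS'] at hder'
      linarith
    have h3 := mul_le_mul_of_nonneg_left h1 (by linarith : 0 ≤ s₁ - w₁)
    have h4 := mul_lt_mul_of_pos_right hlt₁ hD
    linarith
  · rintro u ⟨hu, hder⟩
    obtain ⟨D, W, S, hD, hW, hDeq, hWD, -, hen⟩ := main lam hlam u hu hder.le
    refine lt_of_lt_of_le ?_ hen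
    have h1 : lam * W ≤ lam * (B / d * D) := mul_le_mul_of_nonneg_left hWD hlam.le
    have h2 : 1 / w₁ * (lam * W) < (1 / g₂ - 1 / s₁) * D := by
      rw [one_div_mul_eq_div, div_lt_iff₀ hw₁0]
      have h4 := mul_lt_mul_of_pos_right hlt₂ hD
      linarith
    -- S ≤ D by the constraint, as λW ≥ 0.
    have h3 : 1 / s₁ * S ≤ 1 / s₁ * D :=
      mul_le_mul_of_nonneg_left (by linarith [mul_nonneg hlam.le hW]) (by positivity)
    linarith
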